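/- Let $k$ be an algebraically closed field of characteristic zero and let $G$ be a finite group with trivial center, $Z(G)=1$. Let $F\trianglelefteq G$ be a normal subgroup of prime index. Let $S\subseteq G$ be a subgroup and let $\alpha\in Z^2(S,k^*)$ be a non-degenerate $2$-cocycle, i.e. $s=1$ is the only element $s\in S$ with $\alpha(s,t)=\alpha(t,s)$ for all $t\in C_S(s)$. Let $k_\alpha S$ be the twisted group algebra, with basis $(x_s)_{s\in S}$ and $x_sx_t=\alpha(s,t)x_{st}$, and let $$A=A(G,S,\alpha)=\{f:G\to k_\alpha S \;:\; f(sg)=x_s f(g)x_s^{-1}\ \text{ for all } s\in S,\ g\in G\},$$ an algebra under pointwise operations with $G$-action $(g.f)(h)=f(hg)$, equivalently with coaction $\rho(a)=a_{(0)}\otimes a_{(1)}=\sum_{g\in G}g.a\otimes e_g$ of the Hopf algebra $k^G$ of functions on $G$, where $e_g(h)=\delta_{g,h}$. Then $A$ is a $k^G$-Galois object: $A\neq 0$, $A^{\mathrm{co}\,k^G}=k$, and $\mathrm{can}:A\otimes A\to A\otimes k^G$, $x\otimes y\mapsto xy_{(0)}\otimes y_{(1)}$, is bijective. The Miyashita–Ulbrich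 action of $k^G$ on $A$ is $x\leftharpoonup h=h^{[1]}xh^{[2]}$, where $\mathrm{can}(h^{[1]}\otimes h^{[2]})=1\otimes h$. Let $A^F=\{a\in A : g.a=a\ \text{ for all } g\in F\}$. (1) $A^F$ is a $k^G$-submodule of $A$ with respect to the Miyashita–Ulbrich action if and only if $S\subseteq F$. (2) Let $J\in kS\otimes kS\subseteq kG\otimes kG$ be a twist of $kG$ corresponding to $A$. That is, $J$ is invertible, $(J\otimes 1)(\Delta\otimes\mathrm{id})(J)=(1\otimes J)(\mathrm{id}\otimes\Delta)(J)$, $(\varepsilon\otimes\mathrm{id})(J)=1=(\mathrm{id}\otimes\varepsilon)(J)$, and $A$ is isomorphic, as an algebra with $G$-action, to the space $k^G=(kG)^*$ with product $(ff')(x)=(f\otimes f')(J\Delta(x))$, unit $\varepsilon$ and action $(g.f)(x)=f(xg)$. Let $(kG)^J$ be the Hopf algebra with underlying algebra $kG$ and comultiplication $\Delta_J(x)=J\Delta(x)J^{-1}$, and let $\overline J$ be the image of $J$ in $k(G/F)\otimes k(G/F)$. Then the quotient $(kG)^J\to k(G/F)^{\overline J}$ is conormal (i.e. the dual inclusion identifies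 $(k(G/F)^{\overline J})^*$ with a normal Hopf subalgebra of $((kG)^J)^*$, one stable under the left and right adjoint actions) if and only if $J\in kF\otimes kF$. Moreover the two equivalences express the same condition: for every $J$ as in (2), the quotient $(kG)^J\to k(G/F)^{\overline J}$ is conormal if and only if $A^F$ is a $k^G$-submodule of $A$ with respect to the Miyashita–Ulbrich action. -/

import Mathlib

open scoped TensorProduct

noncomputable section

/-! ### Twists of Hopf algebras and twisted Hopf algebras -/

section Twisting

variable {k : Type*} [Field k]

/-- A (normalized) twist of a Hopf algebra `H`: an invertible `J ∈ H ⊗ H` with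
`(J ⊗ 1) (Δ ⊗ id)(J) = (1 ⊗ J) (id ⊗ Δ)(J)` and `(ε ⊗ id)(J) = 1 = (id ⊗ ε)(J)`.
For `H` finite dimensional this is the same thing as a convolution invertible normalized
`2`-cocycle on the dual Hopf algebra. -/
structure HopfTwist (k H : Type*) [Field k] [Ring H] [HopfAlgebra k H] where
  /-- the underlying invertible element -/
  val : (H ⊗[k] H)ˣ
  cocycle :
    Algebra.TensorProduct.assoc k k k H H H
        ((val : H ⊗[k] H) ⊗ₜ[k] (1 : H)) *
      Algebra.TensorProduct.assoc k k k H H H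
        (Algebra.TensorProduct.map (Bialgebra.comulAlgHom k H) (AlgHom.id k H) (val : H ⊗[k] H)) =
    ((1 : H) ⊗ₜ[k] (val : H ⊗[k] H)) *
      Algebra.TensorProduct.map (AlgHom.id k H) (Bialgebra.comulAlgHom k H) (val : H ⊗[k] H)
  counit_left : Algebra.TensorProduct.lid k H
    (Algebra.TensorProduct.map (Bialgebra.counitAlgHom k H) (AlgHom.id k H) (val : H ⊗[k] H)) = 1
  counit_right : Algebra.TensorProduct.rid k k H
    (Algebra.TensorProduct.map (AlgHom.id k H) (Bialgebra.counitAlgHom k H) (val : H ⊗[k] H)) = 1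

namespace HopfTwist

variable {H H' : Type*} [Ring H] [HopfAlgebra k H] [Ring H'] [HopfAlgebra k H']

/-- The image `(φ ⊗ φ)(J)` of a twist under a homomorphism of Hopf algebras. -/
def map (φ : H →ₐc[k] H') (J : HopfTwist k H) : HopfTwist k H' where
  val := Units.map
    (Algebra.TensorProduct.map (φ : H →ₐ[k] H') (φ : H →ₐ[k] H') :
      H ⊗[k] H →* H' ⊗[k] H') J.val
  cocycle := by
    let Φ : H ⊗[k] (H ⊗[k] H) →ₐ[k] H' ⊗[k] (H' ⊗[k] H') :=
      Algebra.TensorProduct.map (φ : H →ₐ[k] H')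
        (Algebra.TensorProduct.map (φ : H →ₐ[k] H') (φ : H →ₐ[k] H'))
    let φ₂ : H ⊗[k] H →ₐ[k] H' ⊗[k] H' :=
      Algebra.TensorProduct.map (φ : H →ₐ[k] H') (φ : H →ₐ[k] H')
    have hφ : ∀ x : H, Bialgebra.comulAlgHom k H' (φ x) = φ₂ (Bialgebra.comulAlgHom k H x) :=
      fun x => (DFunLike.congr_fun (BialgHomClass.map_comp_comulAlgHom φ) x).symm
    have h1 : ∀ y : H ⊗[k] H, Φ (Algebra.TensorProduct.assoc k k k H H H (y ⊗ₜ[k] (1 : H))) =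
        Algebra.TensorProduct.assoc k k k H' H' H' (φ₂ y ⊗ₜ[k] (1 : H')) := by
      intro y
      induction y with
      | zero => simp
      | tmul a b => simp [Φ, φ₂]
      | add a b ha hb => simp only [TensorProduct.add_tmul, map_add, ha, hb]
    have h2 : ∀ y : H ⊗[k] H, Φ ((1 : H) ⊗ₜ[k] y) = (1 : H') ⊗ₜ[k] φ₂ y := by
      intro y
      simp [Φ, φ₂]
    have h3 : ∀ y : H ⊗[k] H, Φ (Algebra.TensorProduct.map (AlgHom.id k H)
        (Bialgebra.comulAlgHom k H) y) =
        Algebra.TensorProduct.map (AlgHom.id k H') (Bialgebra.comulAlgHom k H') (φ₂ y) := by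
      intro y
      induction y with
      | zero => simp
      | tmul a b =>
        have := hφ b
        simp only [Φ, φ₂, Algebra.TensorProduct.map_tmul, AlgHom.coe_id, id_eq] at this ⊢
        rw [← this]
        rfl
      | add a b ha hb => simp only [map_add, ha, hb]
    have h4 : ∀ y : H ⊗[k] H, Φ (Algebra.TensorProduct.assoc k k k H H H
        (Algebra.TensorProduct.map (Bialgebra.comulAlgHom k H) (AlgHom.id k H) y)) =
        Algebra.TensorProduct.assoc k k k H' H' H'
          (Algebra.TensorProduct.map (Bialgebra.comulAlgHom k H') (AlgHom.id k H') (φ₂ y)) := by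
      have h5 : ∀ (z : H ⊗[k] H) (c : H),
          Φ (Algebra.TensorProduct.assoc k k k H H H (z ⊗ₜ[k] c)) =
          Algebra.TensorProduct.assoc k k k H' H' H' (φ₂ z ⊗ₜ[k] φ c) := by
        intro z c
        induction z with
        | zero => simp
        | tmul a b => simp [Φ, φ₂]
        | add a b ha hb => simp only [TensorProduct.add_tmul, map_add, ha, hb]
      intro y
      induction y with
      | zero => simp
      | tmul a b =>
        rw [Algebra.TensorProduct.map_tmul, h5, ← hφ a]
        simp [φ₂]
      | add a b ha hb => simp only [map_add, ha, hb]
    have key := congrArg Φ J.cocycle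
    rw [map_mul, map_mul, h1, h2, h3, h4] at key
    exact key
  counit_left := by
    have h : ∀ y : H ⊗[k] H, Algebra.TensorProduct.lid k H'
        (Algebra.TensorProduct.map (Bialgebra.counitAlgHom k H') (AlgHom.id k H')
          (Algebra.TensorProduct.map (φ : H →ₐ[k] H') (φ : H →ₐ[k] H') y)) =
        φ (Algebra.TensorProduct.lid k H
        (Algebra.TensorProduct.map (Bialgebra.counitAlgHom k H) (AlgHom.id k H) y)) := by
      intro y
      induction y with
      | zero => simp
      | tmul a b => simp
      | add a b ha hb => simp only [map_add, ha, hb]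
    have := h J.val
    rw [J.counit_left, map_one] at this
    exact this
  counit_right := by
    have h : ∀ y : H ⊗[k] H, Algebra.TensorProduct.rid k k H'
        (Algebra.TensorProduct.map (AlgHom.id k H') (Bialgebra.counitAlgHom k H')
          (Algebra.TensorProduct.map (φ : H →ₐ[k] H') (φ : H →ₐ[k] H') y)) =
        φ (Algebra.TensorProduct.rid k k H
        (Algebra.TensorProduct.map (AlgHom.id k H) (Bialgebra.counitAlgHom k H) y)) := by
      intro y
      induction y with
      | zero => simp
      | tmul a b => simp
      | add a b ha hb => simp only [map_add, ha, hb]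
    have := h J.val
    rw [J.counit_right, map_one] at this
    exact this

/-- The underlying algebra of the twisted Hopf algebra `H^J`, which is that of `H`. -/
def Twisted (_J : HopfTwist k H) : Type _ := H

variable (J : HopfTwist k H)

instance : Ring J.Twisted := inferInstanceAs (Ring H)

instance : Algebra k J.Twisted := inferInstanceAs (Algebra k H)

/-- The twisted comultiplication `Δ_J(x) = J Δ(x) J⁻¹`. -/
def twistedComul : H →ₐ[k] H ⊗[k] H :=
  AlgHom.ofLinearMap
    (LinearMap.mulLeft k (J.val : H ⊗[k] H) ∘ₗ
      LinearMap.mulRight k ((J.val⁻¹ : (H ⊗[k] H)ˣ) : H ⊗[k] H) ∘ₗ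
      (Bialgebra.comulAlgHom k H).toLinearMap)
    (by simp)
    (by intro x y; simp [mul_assoc])

lemma twistedComul_apply (x : H) : J.twistedComul x =
    (J.val : H ⊗[k] H) * (Bialgebra.comulAlgHom k H x *
      ((J.val⁻¹ : (H ⊗[k] H)ˣ) : H ⊗[k] H)) := rfl

lemma cocycle_inv :
    Algebra.TensorProduct.assoc k k k H H H
        (Algebra.TensorProduct.map (Bialgebra.comulAlgHom k H) (AlgHom.id k H)
          ((J.val⁻¹ : (H ⊗[k] H)ˣ) : H ⊗[k] H)) *
      Algebra.TensorProduct.assoc k k k H H H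
        (((J.val⁻¹ : (H ⊗[k] H)ˣ) : H ⊗[k] H) ⊗ₜ[k] (1 : H)) =
    Algebra.TensorProduct.map (AlgHom.id k H) (Bialgebra.comulAlgHom k H)
        ((J.val⁻¹ : (H ⊗[k] H)ˣ) : H ⊗[k] H) *
      ((1 : H) ⊗ₜ[k] ((J.val⁻¹ : (H ⊗[k] H)ˣ) : H ⊗[k] H)) := by
  let f1 : H ⊗[k] H →ₐ[k] H ⊗[k] (H ⊗[k] H) :=
    (Algebra.TensorProduct.assoc k k k H H H).toAlgHom.comp
      Algebra.TensorProduct.includeLeft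
  let f2 : H ⊗[k] H →ₐ[k] H ⊗[k] (H ⊗[k] H) :=
    (Algebra.TensorProduct.assoc k k k H H H).toAlgHom.comp
      (Algebra.TensorProduct.map (Bialgebra.comulAlgHom k H) (AlgHom.id k H))
  let g1 : H ⊗[k] H →ₐ[k] H ⊗[k] (H ⊗[k] H) := Algebra.TensorProduct.includeRight
  let g2 : H ⊗[k] H →ₐ[k] H ⊗[k] (H ⊗[k] H) :=
    Algebra.TensorProduct.map (AlgHom.id k H) (Bialgebra.comulAlgHom k H)
  have h : Units.map (f1 : H ⊗[k] H →* H ⊗[k] (H ⊗[k] H)) J.val *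
        Units.map (f2 : H ⊗[k] H →* H ⊗[k] (H ⊗[k] H)) J.val =
      Units.map (g1 : H ⊗[k] H →* H ⊗[k] (H ⊗[k] H)) J.val * Units.map (g2 : H ⊗[k] H →* H ⊗[k] (H ⊗[k] H)) J.val :=
    Units.ext J.cocycle
  have h' := congrArg (fun u => ((u⁻¹ : (H ⊗[k] (H ⊗[k] H))ˣ) : H ⊗[k] (H ⊗[k] H))) h
  simp only [mul_inv_rev, Units.val_mul] at h'
  exact h'

lemma twistedComul_coassoc (x : H) :
    Algebra.TensorProduct.assoc k k k H H H
      (Algebra.TensorProduct.map J.twistedComul (AlgHom.id k H) (J.twistedComul x)) =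
    Algebra.TensorProduct.map (AlgHom.id k H) J.twistedComul (J.twistedComul x) := by
  have h1 : ∀ y : H ⊗[k] H, Algebra.TensorProduct.map J.twistedComul (AlgHom.id k H) y =
      ((J.val : H ⊗[k] H) ⊗ₜ[k] (1 : H)) *
        (Algebra.TensorProduct.map (Bialgebra.comulAlgHom k H) (AlgHom.id k H) y *
        (((J.val⁻¹ : (H ⊗[k] H)ˣ) : H ⊗[k] H) ⊗ₜ[k] (1 : H))) := by
    intro y
    induction y with
    | zero => simp
    | tmul a b =>
      simp only [Algebra.TensorProduct.map_tmul, Algebra.TensorProduct.tmul_mul_tmul,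
        twistedComul_apply, AlgHom.coe_id, id_eq, one_mul, mul_one]
    | add a b ha hb => simp only [map_add, ha, hb, mul_add, add_mul]
  have h2 : ∀ y : H ⊗[k] H, Algebra.TensorProduct.map (AlgHom.id k H) J.twistedComul y =
      ((1 : H) ⊗ₜ[k] (J.val : H ⊗[k] H)) *
        (Algebra.TensorProduct.map (AlgHom.id k H) (Bialgebra.comulAlgHom k H) y *
        ((1 : H) ⊗ₜ[k] ((J.val⁻¹ : (H ⊗[k] H)ˣ) : H ⊗[k] H))) := by
    intro y
    induction y with
    | zero => simp
    | tmul a b =>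
      simp only [Algebra.TensorProduct.map_tmul, Algebra.TensorProduct.tmul_mul_tmul,
        twistedComul_apply, AlgHom.coe_id, id_eq, one_mul, mul_one]
    | add a b ha hb => simp only [map_add, ha, hb, mul_add, add_mul]
  have h3 : Algebra.TensorProduct.assoc k k k H H H
      (Algebra.TensorProduct.map (Bialgebra.comulAlgHom k H) (AlgHom.id k H)
        (Bialgebra.comulAlgHom k H x)) =
      Algebra.TensorProduct.map (AlgHom.id k H) (Bialgebra.comulAlgHom k H)
        (Bialgebra.comulAlgHom k H x) := Coalgebra.coassoc_apply x
  rw [h1, h2, twistedComul_apply]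
  simp only [map_mul]
  rw [h3]
  have c1 := J.cocycle
  have c2 := J.cocycle_inv
  simp only [← mul_assoc] at c1 ⊢
  rw [c1]
  simp only [mul_assoc]
  rw [c2]

lemma counit_left_inv : Algebra.TensorProduct.lid k H
    (Algebra.TensorProduct.map (Bialgebra.counitAlgHom k H) (AlgHom.id k H)
      ((J.val⁻¹ : (H ⊗[k] H)ˣ) : H ⊗[k] H)) = 1 := by
  have h : Algebra.TensorProduct.lid k H
      (Algebra.TensorProduct.map (Bialgebra.counitAlgHom k H) (AlgHom.id k H)
        ((J.val : H ⊗[k] H) * ((J.val⁻¹ : (H ⊗[k] H)ˣ) : H ⊗[k] H))) = 1 := by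
    rw [Units.mul_inv, map_one, map_one]
  rwa [map_mul, map_mul, J.counit_left, one_mul] at h

lemma counit_right_inv : Algebra.TensorProduct.rid k k H
    (Algebra.TensorProduct.map (AlgHom.id k H) (Bialgebra.counitAlgHom k H)
      ((J.val⁻¹ : (H ⊗[k] H)ˣ) : H ⊗[k] H)) = 1 := by
  have h : Algebra.TensorProduct.rid k k H
      (Algebra.TensorProduct.map (AlgHom.id k H) (Bialgebra.counitAlgHom k H)
        ((J.val : H ⊗[k] H) * ((J.val⁻¹ : (H ⊗[k] H)ˣ) : H ⊗[k] H))) = 1 := by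
    rw [Units.mul_inv, map_one, map_one]
  rwa [map_mul, map_mul, J.counit_right, one_mul] at h

/-- The element `U = J¹ S(J²)`. -/
def antipodeUnit : H :=
  LinearMap.mul' k H ((HopfAlgebra.antipode k (A := H)).lTensor H (J.val : H ⊗[k] H))

/-- The element `S(j¹) j²`, where `J⁻¹ = j¹ ⊗ j²`; it is the inverse of `U`. -/
def antipodeUnitInv : H :=
  LinearMap.mul' k H ((HopfAlgebra.antipode k (A := H)).rTensor H
    ((J.val⁻¹ : (H ⊗[k] H)ˣ) : H ⊗[k] H))

/-- The twisted antipode `S_J(x) = U S(x) U⁻¹`. -/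
def twistedAntipode : H →ₗ[k] H :=
  LinearMap.mulLeft k J.antipodeUnit ∘ₗ LinearMap.mulRight k J.antipodeUnitInv ∘ₗ
    HopfAlgebra.antipode k

/-- The element `U` is invertible with the stated inverse. -/
lemma antipodeUnit_mul_inv : J.antipodeUnit * J.antipodeUnitInv = 1 := by
  let S : H →ₗ[k] H := HopfAlgebra.antipode k
  -- the linear map `a ⊗ b ⊗ c ↦ a S(b) c`
  let Θ : H ⊗[k] (H ⊗[k] H) →ₗ[k] H :=
    LinearMap.mul' k H ∘ₗ (LinearMap.mul' k H ∘ₗ S.rTensor H).lTensor H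
  have hΘ : ∀ a b c : H, Θ (a ⊗ₜ[k] (b ⊗ₜ[k] c)) = a * (S b * c) := fun a b c => rfl
  have hS : ∀ a b : H, S (a * b) = S b * S a := HopfAlgebra.antipode_mul_antidistrib
  have e1 : ∀ X Y : H ⊗[k] H,
      Θ (((1 : H) ⊗ₜ[k] Y) * Algebra.TensorProduct.assoc k k k H H H (X ⊗ₜ[k] (1 : H))) =
      LinearMap.mul' k H (S.lTensor H X) * LinearMap.mul' k H (S.rTensor H Y) := by
    intro X Y
    induction X with
    | zero => simp
    | add a b ha hb => simp only [TensorProduct.add_tmul, map_add, mul_add, ha, hb, add_mul]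
    | tmul a b =>
      induction Y with
      | zero => simp
      | add c d hc hd => simp only [TensorProduct.tmul_add, map_add, mul_add, hc, hd, add_mul]
      | tmul c d =>
        simp only [Algebra.TensorProduct.assoc_tmul, Algebra.TensorProduct.tmul_mul_tmul, hΘ,
          one_mul, mul_one, hS, LinearMap.lTensor_tmul, LinearMap.rTensor_tmul,
          LinearMap.mul'_apply, mul_assoc]
  have e2 : ∀ X Y : H ⊗[k] H,
      Θ (Algebra.TensorProduct.map (AlgHom.id k H) (Bialgebra.comulAlgHom k H) X *
        Algebra.TensorProduct.assoc k k k H H H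
          (Algebra.TensorProduct.map (Bialgebra.comulAlgHom k H) (AlgHom.id k H) Y)) =
      Algebra.TensorProduct.rid k k H
        (Algebra.TensorProduct.map (AlgHom.id k H) (Bialgebra.counitAlgHom k H) X) *
      Algebra.TensorProduct.lid k H
        (Algebra.TensorProduct.map (Bialgebra.counitAlgHom k H) (AlgHom.id k H) Y) := by
    intro X Y
    induction X with
    | zero => simp
    | add a b ha hb => simp only [map_add, add_mul, ha, hb]
    | tmul a b =>
      induction Y with
      | zero => simp
      | add c d hc hd => simp only [map_add, mul_add, hc, hd]
      | tmul c d =>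
        have hm : ∀ (P Q : H ⊗[k] H),
            Θ ((a ⊗ₜ[k] P) * Algebra.TensorProduct.assoc k k k H H H (Q ⊗ₜ[k] d)) =
            a * (LinearMap.mul' k H (S.lTensor H Q) * (LinearMap.mul' k H (S.rTensor H P) * d)) := by
          intro P Q
          induction P with
          | zero => simp
          | add p q hp hq => simp only [TensorProduct.tmul_add, map_add, add_mul, mul_add, hp, hq]
          | tmul p q =>
            induction Q with
            | zero => simp
            | add r s hr hs => simp only [TensorProduct.add_tmul, map_add, add_mul, mul_add, hr, hs]
            | tmul r s =>
              simp only [Algebra.TensorProduct.assoc_tmul, Algebra.TensorProduct.tmul_mul_tmul, hΘ,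
                hS, LinearMap.lTensor_tmul, LinearMap.rTensor_tmul,
                LinearMap.mul'_apply, mul_assoc]
        have hm' := hm (Coalgebra.comul b) (Coalgebra.comul c)
        rw [HopfAlgebra.mul_antipode_lTensor_comul_apply,
          HopfAlgebra.mul_antipode_rTensor_comul_apply] at hm'
        simp only [Algebra.TensorProduct.map_tmul, AlgHom.coe_id, id_eq,
          Bialgebra.comulAlgHom_apply, hm', Algebra.TensorProduct.rid_tmul,
          Algebra.TensorProduct.lid_tmul, Bialgebra.counitAlgHom_apply,
          Algebra.algebraMap_eq_smul_one, smul_mul_assoc, mul_smul_comm, one_mul]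
        rw [smul_comm]
  have key : ((1 : H) ⊗ₜ[k] ((J.val⁻¹ : (H ⊗[k] H)ˣ) : H ⊗[k] H)) *
      Algebra.TensorProduct.assoc k k k H H H ((J.val : H ⊗[k] H) ⊗ₜ[k] (1 : H)) =
      Algebra.TensorProduct.map (AlgHom.id k H) (Bialgebra.comulAlgHom k H) (J.val : H ⊗[k] H) *
        Algebra.TensorProduct.assoc k k k H H H
          (Algebra.TensorProduct.map (Bialgebra.comulAlgHom k H) (AlgHom.id k H)
            ((J.val⁻¹ : (H ⊗[k] H)ˣ) : H ⊗[k] H)) := by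
    have c1 := J.cocycle
    have i1 : ((1 : H) ⊗ₜ[k] ((J.val⁻¹ : (H ⊗[k] H)ˣ) : H ⊗[k] H)) *
        ((1 : H) ⊗ₜ[k] (J.val : H ⊗[k] H)) = 1 := by
      rw [Algebra.TensorProduct.tmul_mul_tmul, Units.inv_mul, one_mul]
      rfl
    have i2 : Algebra.TensorProduct.assoc k k k H H H
        (Algebra.TensorProduct.map (Bialgebra.comulAlgHom k H) (AlgHom.id k H)
          (J.val : H ⊗[k] H)) *
        Algebra.TensorProduct.assoc k k k H H H
        (Algebra.TensorProduct.map (Bialgebra.comulAlgHom k H) (AlgHom.id k H)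
          ((J.val⁻¹ : (H ⊗[k] H)ˣ) : H ⊗[k] H)) = 1 := by
      rw [← map_mul, ← map_mul, Units.mul_inv, map_one, map_one]
    have c2 := congrArg (fun z => ((1 : H) ⊗ₜ[k] ((J.val⁻¹ : (H ⊗[k] H)ˣ) : H ⊗[k] H)) * z *
      Algebra.TensorProduct.assoc k k k H H H
        (Algebra.TensorProduct.map (Bialgebra.comulAlgHom k H) (AlgHom.id k H)
          ((J.val⁻¹ : (H ⊗[k] H)ˣ) : H ⊗[k] H))) c1
    rw [← mul_assoc ((1 : H) ⊗ₜ[k] ((J.val⁻¹ : (H ⊗[k] H)ˣ) : H ⊗[k] H)), mul_assoc, i2, mul_one,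
      ← mul_assoc ((1 : H) ⊗ₜ[k] ((J.val⁻¹ : (H ⊗[k] H)ˣ) : H ⊗[k] H)), i1, one_mul] at c2
    exact c2
  have := congrArg Θ key
  rw [e1, e2, J.counit_right, J.counit_left_inv, mul_one] at this
  exact this

lemma twistedComul_counit_left (x : H) :
    (Coalgebra.counit (R := k) (A := H)).rTensor H (J.twistedComul x) = (1 : k) ⊗ₜ[k] x := by
  refine (Algebra.TensorProduct.lid k H).injective ?_
  change Algebra.TensorProduct.lid k H
    (Algebra.TensorProduct.map (Bialgebra.counitAlgHom k H) (AlgHom.id k H)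
      (J.twistedComul x)) = Algebra.TensorProduct.lid k H ((1 : k) ⊗ₜ[k] x)
  have hx : Algebra.TensorProduct.map (Bialgebra.counitAlgHom k H) (AlgHom.id k H)
      (Bialgebra.comulAlgHom k H x) = (1 : k) ⊗ₜ[k] x := Coalgebra.rTensor_counit_comul x
  rw [twistedComul_apply, map_mul, map_mul, map_mul, map_mul, J.counit_left,
    J.counit_left_inv, hx, one_mul, mul_one]

lemma twistedComul_counit_right (x : H) :
    (Coalgebra.counit (R := k) (A := H)).lTensor H (J.twistedComul x) = x ⊗ₜ[k] (1 : k) := by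
  refine (Algebra.TensorProduct.rid k k H).injective ?_
  change Algebra.TensorProduct.rid k k H
    (Algebra.TensorProduct.map (AlgHom.id k H) (Bialgebra.counitAlgHom k H)
      (J.twistedComul x)) = Algebra.TensorProduct.rid k k H (x ⊗ₜ[k] (1 : k))
  have hx : Algebra.TensorProduct.map (AlgHom.id k H) (Bialgebra.counitAlgHom k H)
      (Bialgebra.comulAlgHom k H x) = x ⊗ₜ[k] (1 : k) := Coalgebra.lTensor_counit_comul x
  rw [twistedComul_apply, map_mul, map_mul, map_mul, map_mul, J.counit_right,
    J.counit_right_inv, hx, one_mul, mul_one]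

lemma twistedAntipode_left (x : H) :
    LinearMap.mul' k H (J.twistedAntipode.rTensor H (J.twistedComul x)) =
      algebraMap k H (Coalgebra.counit (R := k) x) := by
  let S : H →ₗ[k] H := HopfAlgebra.antipode k
  have hS : ∀ a b : H, S (a * b) = S b * S a := HopfAlgebra.antipode_mul_antidistrib
  -- the linear map `a ⊗ b ↦ S(a) w b`
  let L : H → H ⊗[k] H →ₗ[k] H := fun w =>
    LinearMap.mul' k H ∘ₗ (LinearMap.mulRight k w ∘ₗ S).rTensor H
  have hL : ∀ w a b, L w (a ⊗ₜ[k] b) = S a * w * b := fun w a b => rfl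
  have hL0 : ∀ Z, L 0 Z = 0 := by
    intro Z
    induction Z with
    | zero => simp
    | tmul a b => simp [hL]
    | add a b ha hb => rw [map_add, ha, hb, add_zero]
  have hLadd : ∀ w w' Z, L (w + w') Z = L w Z + L w' Z := by
    intro w w' Z
    induction Z with
    | zero => simp
    | tmul a b => simp [hL, mul_add, add_mul]
    | add a b ha hb => rw [map_add, ha, hb, map_add, map_add]; abel
  have hLmul : ∀ w Z Z', L w (Z * Z') = L (L w Z) Z' := by
    intro w Z Z'
    induction Z with
    | zero => simp [hL0]
    | add a b ha hb => rw [add_mul, map_add, map_add, hLadd, ha, hb]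
    | tmul a b =>
      induction Z' with
      | zero => simp
      | add c d hc hd => rw [mul_add, map_add, map_add, hc, hd]
      | tmul c d => simp [hL, hS, mul_assoc]
  have hU : ∀ Z, LinearMap.mul' k H (J.twistedAntipode.rTensor H Z) =
      J.antipodeUnit * L J.antipodeUnitInv Z := by
    intro Z
    induction Z with
    | zero => simp
    | add a b ha hb => simp only [map_add, ha, hb, mul_add]
    | tmul a b => simp [hL, twistedAntipode, S, mul_assoc]
  have h1 : ∀ Z, L 1 Z = LinearMap.mul' k H (S.rTensor H Z) := by
    intro Z
    simp [L, LinearMap.mulRight_one]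
  have hLone : ∀ w, L w 1 = w := by
    intro w
    rw [Algebra.TensorProduct.one_def, hL]
    simp [S]
  have hLs : ∀ (c : k) (Z), L (algebraMap k H c) Z = c • L 1 Z := by
    intro c Z
    induction Z with
    | zero => simp
    | tmul a b => simp [hL, Algebra.algebraMap_eq_smul_one]
    | add a b ha hb => rw [map_add, ha, hb, map_add, smul_add]
  have hV : J.antipodeUnitInv = L 1 ((J.val⁻¹ : (H ⊗[k] H)ˣ) : H ⊗[k] H) := (h1 _).symm
  have hx : L 1 (Bialgebra.comulAlgHom k H x) = algebraMap k H (Coalgebra.counit (R := k) x) := by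
    rw [h1]
    exact HopfAlgebra.mul_antipode_rTensor_comul_apply x
  rw [hU, twistedComul_apply, hLmul, hLmul]
  conv_lhs => rw [hV]
  rw [← hLmul 1 _ (J.val : H ⊗[k] H), Units.inv_mul, hLone, hx, hLs, ← hV, mul_smul_comm,
    antipodeUnit_mul_inv, Algebra.algebraMap_eq_smul_one]

lemma twistedAntipode_right (x : H) :
    LinearMap.mul' k H (J.twistedAntipode.lTensor H (J.twistedComul x)) =
      algebraMap k H (Coalgebra.counit (R := k) x) := by
  let S : H →ₗ[k] H := HopfAlgebra.antipode k
  have hS : ∀ a b : H, S (a * b) = S b * S a := HopfAlgebra.antipode_mul_antidistrib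
  -- the linear map `a ⊗ b ↦ a w S(b)`
  let R : H → H ⊗[k] H →ₗ[k] H := fun w =>
    LinearMap.mul' k H ∘ₗ (LinearMap.mulLeft k w ∘ₗ S).lTensor H
  have hR : ∀ w a b, R w (a ⊗ₜ[k] b) = a * (w * S b) := fun w a b => rfl
  have hR0 : ∀ Z, R 0 Z = 0 := by
    intro Z
    induction Z with
    | zero => simp
    | tmul a b => simp [hR]
    | add a b ha hb => rw [map_add, ha, hb, add_zero]
  have hRadd : ∀ w w' Z, R (w + w') Z = R w Z + R w' Z := by
    intro w w' Z
    induction Z with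
    | zero => simp
    | tmul a b => simp [hR, mul_add, add_mul]
    | add a b ha hb => rw [map_add, ha, hb, map_add, map_add]; abel
  have hRmul : ∀ w Z Z', R w (Z * Z') = R (R w Z') Z := by
    intro w Z Z'
    induction Z' with
    | zero => simp [hR0]
    | add a b ha hb => rw [mul_add, map_add, map_add, hRadd, ha, hb]
    | tmul a b =>
      induction Z with
      | zero => simp
      | add c d hc hd => rw [add_mul, map_add, map_add, hc, hd]
      | tmul c d => simp [hR, hS, mul_assoc]
  have hU : ∀ Z, LinearMap.mul' k H (J.twistedAntipode.lTensor H Z) =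
      R J.antipodeUnit Z * J.antipodeUnitInv := by
    intro Z
    induction Z with
    | zero => simp
    | add a b ha hb => simp only [map_add, ha, hb, add_mul]
    | tmul a b => simp [hR, twistedAntipode, S, mul_assoc]
  have h1 : ∀ Z, R 1 Z = LinearMap.mul' k H (S.lTensor H Z) := by
    intro Z
    simp [R, LinearMap.mulLeft_one]
  have hRone : ∀ w, R w 1 = w := by
    intro w
    rw [Algebra.TensorProduct.one_def, hR]
    simp [S]
  have hRs : ∀ (c : k) (Z), R (algebraMap k H c) Z = c • R 1 Z := by
    intro c Z
    induction Z with
    | zero => simp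
    | tmul a b => simp [hR, Algebra.algebraMap_eq_smul_one]
    | add a b ha hb => rw [map_add, ha, hb, map_add, smul_add]
  have hV : J.antipodeUnit = R 1 (J.val : H ⊗[k] H) := (h1 _).symm
  have hx : R 1 (Bialgebra.comulAlgHom k H x) = algebraMap k H (Coalgebra.counit (R := k) x) := by
    rw [h1]
    exact HopfAlgebra.mul_antipode_lTensor_comul_apply x
  rw [hU, twistedComul_apply, hRmul, hRmul]
  conv_lhs => rw [hV]
  rw [← hRmul 1 ((J.val⁻¹ : (H ⊗[k] H)ˣ) : H ⊗[k] H), Units.inv_mul, hRone, hx, hRs, ← hV,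
    smul_mul_assoc, antipodeUnit_mul_inv, Algebra.algebraMap_eq_smul_one]

instance : Coalgebra k J.Twisted where
  comul := J.twistedComul.toLinearMap
  counit := Coalgebra.counit (R := k) (A := H)
  coassoc := LinearMap.ext J.twistedComul_coassoc
  rTensor_counit_comp_comul := LinearMap.ext J.twistedComul_counit_left
  lTensor_counit_comp_comul := LinearMap.ext J.twistedComul_counit_right

instance : Bialgebra k J.Twisted :=
  Bialgebra.mk' k J.Twisted
    (map_one (Bialgebra.counitAlgHom k H))
    (fun {a b} => map_mul (Bialgebra.counitAlgHom k H) a b)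
    (map_one J.twistedComul)
    (fun {a b} => map_mul J.twistedComul a b)

/-- The twisted Hopf algebra `H^J`: the algebra `H` with comultiplication `J Δ(x) J⁻¹`, the
counit of `H` and antipode `U S(x) U⁻¹`. -/
instance : HopfAlgebra k J.Twisted where
  antipode := J.twistedAntipode
  mul_antipode_rTensor_comul := LinearMap.ext J.twistedAntipode_left
  mul_antipode_lTensor_comul := LinearMap.ext J.twistedAntipode_right

instance [FiniteDimensional k H] : FiniteDimensional k J.Twisted :=
  inferInstanceAs (FiniteDimensional k H)

lemma map_twistedComul (φ : H →ₐc[k] H') (x : H) :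
    Algebra.TensorProduct.map (φ : H →ₐ[k] H') (φ : H →ₐ[k] H') (J.twistedComul x) =
      (J.map φ).twistedComul (φ x) := by
  have hφ : Algebra.TensorProduct.map (φ : H →ₐ[k] H') (φ : H →ₐ[k] H')
      (Bialgebra.comulAlgHom k H x) = Bialgebra.comulAlgHom k H' (φ x) :=
    DFunLike.congr_fun (BialgHomClass.map_comp_comulAlgHom φ) x
  rw [twistedComul_apply, twistedComul_apply, map_mul, map_mul, hφ]
  rfl

/-- A homomorphism of Hopf algebras `φ : H → H'` is also one from `H^J` to `H'^((φ ⊗ φ)(J))`. -/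
def twistedMap (φ : H →ₐc[k] H') : J.Twisted →ₐc[k] (J.map φ).Twisted :=
  BialgHom.ofAlgHom (A := J.Twisted) (B := (J.map φ).Twisted) (φ : H →ₐ[k] H')
    (BialgHomClass.counitAlgHom_comp φ)
    (AlgHom.ext (J.map_twistedComul φ))

end HopfTwist

end Twisting

/-! ### The dual of a finite dimensional Hopf algebra, normality and conormality -/

section Conormality

open Module

variable {k : Type*} [Field k] {K K' : Type*} [Ring K] [HopfAlgebra k K] [Ring K']
  [HopfAlgebra k K']

/-- The multiplication of the dual Hopf algebra `K*`: `(f g)(x) = f(x₁) g(x₂)`. -/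
def dualMul (k K : Type*) [Field k] [Ring K] [HopfAlgebra k K] :
    Dual k K →ₗ[k] Dual k K →ₗ[k] Dual k K :=
  TensorProduct.curry
    ((Coalgebra.comul (R := k) (A := K)).dualMap ∘ₗ TensorProduct.dualDistrib k K K)

/-- The comultiplication of the dual Hopf algebra `K*` of a finite dimensional `K`:
`f₁(x) f₂(y) = f(x y)`. -/
def dualComul (k K : Type*) [Field k] [Ring K] [HopfAlgebra k K] [FiniteDimensional k K] :
    Dual k K →ₗ[k] Dual k K ⊗[k] Dual k K :=
  (TensorProduct.dualDistribEquiv k K K).symm.toLinearMap ∘ₗ (LinearMap.mul' k K).dualMap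

/-- The antipode of the dual Hopf algebra `K*`. -/
def dualAntipode (k K : Type*) [Field k] [Ring K] [HopfAlgebra k K] :
    Dual k K →ₗ[k] Dual k K :=
  (HopfAlgebra.antipode k (A := K)).dualMap

/-- The left adjoint action of `K*` on itself: `f ⬝ g = f₁ g S(f₂)`. -/
def dualAdjointLeft [FiniteDimensional k K] (f g : Dual k K) : Dual k K :=
  TensorProduct.lift
    (((dualMul k K).compl₂ (dualAntipode k K)) ∘ₗ (dualMul k K).flip g) (dualComul k K f)

/-- The right adjoint action of `K*` on itself: `g ⬝ f = S(f₁) g f₂`. -/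
def dualAdjointRight [FiniteDimensional k K] (f g : Dual k K) : Dual k K :=
  TensorProduct.lift
    (dualMul k K ∘ₗ (dualMul k K).flip g ∘ₗ dualAntipode k K) (dualComul k K f)

/-- A subspace of the dual Hopf algebra `K*` that is stable under both adjoint actions; a Hopf
subalgebra of `K*` with this property is called normal. -/
def IsNormalInDual [FiniteDimensional k K] (W : Submodule k (Dual k K)) : Prop :=
  ∀ f : Dual k K, ∀ g ∈ W, dualAdjointLeft f g ∈ W ∧ dualAdjointRight f g ∈ W

/-- A quotient `π : K → K'` of finite dimensional Hopf algebras is conormal if it is dual to a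
normal inclusion: it is surjective, and the image of the inclusion `π* : K'* → K*` is a normal
Hopf subalgebra of `K*` (the image of `π*` is always a Hopf subalgebra). -/
def IsConormal [FiniteDimensional k K] (π : K →ₐc[k] K') : Prop :=
  Function.Surjective π ∧
    IsNormalInDual (LinearMap.range ((π : K →ₐ[k] K').toLinearMap.dualMap))

end Conormality

/-! ### Galois objects over `k^G` and the Miyashita-Ulbrich action -/

section Galois

variable (k G A : Type*) [Field k] [Group G] [Fintype G] [DecidableEq G]
  [Ring A] [Algebra k A] [MulSemiringAction G A] [SMulCommClass G k A]

/-- The coaction `ρ : A → A ⊗ k^G`, `ρ(a) = ∑ g, g.a ⊗ e_g` of the Hopf algebra `k^G` of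
functions on `G` on a `G`-algebra `A`. -/
def galoisCoaction : A →ₗ[k] A ⊗[k] (G → k) :=
  ∑ g : G, (TensorProduct.mk k A (G → k)).flip (Pi.single g 1) ∘ₗ
    DistribSMul.toLinearMap k A g

/-- The canonical map `A ⊗ A → A ⊗ k^G`, `x ⊗ y ↦ x y₀ ⊗ y₁`. -/
def galoisCan : A ⊗[k] A →ₗ[k] A ⊗[k] (G → k) :=
  (LinearMap.mul' k A).rTensor (G → k) ∘ₗ
    (TensorProduct.assoc k A A (G → k)).symm.toLinearMap ∘ₗ
    (galoisCoaction k G A).lTensor A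

/-- The `G`-algebra `A` is a (right) `k^G`-Galois object: a `k^G`-Galois extension of `k`. -/
structure IsGaloisObject : Prop where
  nontrivial : Nontrivial A
  coinvariants : ∀ a : A,
    galoisCoaction k G A a = a ⊗ₜ[k] (1 : G → k) ↔ a ∈ (⊥ : Subalgebra k A)
  can_bijective : Function.Bijective (galoisCan k G A)

variable {A}

/-- The linear map `A ⊗ A → A`, `a ⊗ b ↦ a x b`. -/
def sandwich (x : A) : A ⊗[k] A →ₗ[k] A :=
  TensorProduct.lift (LinearMap.mul k A ∘ₗ LinearMap.mulRight k x)

/-- The Miyashita-Ulbrich action `x ↼ h = h^[1] x h^[2]` of `h ∈ k^G` on an element `x` of the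
Galois object `A`, where `can (h^[1] ⊗ h^[2]) = 1 ⊗ h`, that is, `h^[1] ⊗ h^[2]` is the preimage
of `1 ⊗ h` under the bijective map `can`. -/
def miyashitaUlbrich (x : A) (h : G → k) : A :=
  sandwich k x (Function.invFun (galoisCan k G A) ((1 : A) ⊗ₜ[k] h))

variable {k}

/-- The subspace `W` is a `k^G`-submodule of `A` with respect to the Miyashita-Ulbrich action. -/
def IsMiyashitaUlbrichStable (W : Submodule k A) : Prop :=
  ∀ x ∈ W, ∀ h : G → k, miyashitaUlbrich k G x h ∈ W

variable (k) {G} (A)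

/-- The subspace `A^F` of `F`-invariants. -/
def fixedSubspace (F : Subgroup G) : Submodule k A where
  carrier := {a | ∀ g ∈ F, g • a = a}
  zero_mem' := fun g _ => smul_zero g
  add_mem' := fun ha hb g hg => by rw [smul_add, ha g hg, hb g hg]
  smul_mem' := fun c a ha g hg => by rw [smul_comm, ha g hg]

end Galois

/-! ### Twisted group algebras -/

section TwistedGroupAlgebra

/-- A `2`-cocycle on the group `S` with values in `kˣ` (with trivial action). -/
structure TwoCocycle (S k : Type*) [Group S] [Field k] where
  /-- the underlying function -/
  toFun : S → S → kˣ
  cocycle : ∀ s t u : S, toFun s t * toFun (s * t) u = toFun t u * toFun s (t * u)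

namespace TwoCocycle

variable {S k : Type*} [Group S] [Field k] (α : TwoCocycle S k)

/-- An element `s` is `α`-regular if `α(s,t) = α(t,s)` for all `t` in the centralizer of `s`. -/
def IsRegular (s : S) : Prop := ∀ t : S, s * t = t * s → α.toFun s t = α.toFun t s

/-- The cocycle `α` is non-degenerate if the identity is the only `α`-regular element. -/
def IsNondegenerate : Prop := ∀ s : S, α.IsRegular s ↔ s = 1

lemma toFun_one_left (s : S) : α.toFun 1 s = α.toFun 1 1 := by
  have h := α.cocycle 1 1 s
  simp only [one_mul] at h
  exact (mul_right_cancel h).symm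

lemma toFun_one_right (s : S) : α.toFun s 1 = α.toFun 1 1 := by
  have h := α.cocycle s 1 1
  simp only [mul_one] at h
  exact mul_right_cancel h

lemma toFun_inv_comm (s : S) : α.toFun s⁻¹ s = α.toFun s s⁻¹ := by
  have h := α.cocycle s s⁻¹ s
  rw [mul_inv_cancel, inv_mul_cancel, toFun_one_left, toFun_one_right α s] at h
  exact (mul_right_cancel h).symm

/-- The twisted group algebra `k_α S`: the vector space with basis `x_s`, `s ∈ S`, and
multiplication `x_s x_t = α(s,t) x_{st}`. Its unit is `α(1,1)⁻¹ x_1`. -/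
def TwistedGroupAlgebra (_α : TwoCocycle S k) : Type _ := S →₀ k

namespace TwistedGroupAlgebra

instance : AddCommGroup α.TwistedGroupAlgebra := inferInstanceAs (AddCommGroup (S →₀ k))

instance : Module k α.TwistedGroupAlgebra := inferInstanceAs (Module k (S →₀ k))

/-- The standard basis `(x_s)` of the twisted group algebra. -/
def basis : Module.Basis S k α.TwistedGroupAlgebra :=
  Module.Basis.ofRepr (LinearEquiv.refl k (S →₀ k) : α.TwistedGroupAlgebra ≃ₗ[k] (S →₀ k))

/-- The basis vector `x_s` of the twisted group algebra. -/
def x (s : S) : α.TwistedGroupAlgebra := basis α s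

/-- The multiplication of the twisted group algebra, as a bilinear map. -/
def mulMap : α.TwistedGroupAlgebra →ₗ[k] α.TwistedGroupAlgebra →ₗ[k] α.TwistedGroupAlgebra :=
  (basis α).constr k fun s => (basis α).constr k fun t => (α.toFun s t : k) • x α (s * t)

instance : Mul α.TwistedGroupAlgebra := ⟨fun a b => mulMap α a b⟩

instance : One α.TwistedGroupAlgebra := ⟨((α.toFun 1 1)⁻¹ : kˣ).val • x α 1⟩

lemma mul_def (a b : α.TwistedGroupAlgebra) : a * b = mulMap α a b := rfl

lemma one_def : (1 : α.TwistedGroupAlgebra) = ((α.toFun 1 1)⁻¹ : kˣ).val • x α 1 := rfl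

lemma x_mul_x (s t : S) : x α s * x α t = (α.toFun s t : k) • x α (s * t) := by
  rw [mul_def, mulMap, x, x, Module.Basis.constr_basis, Module.Basis.constr_basis]

/-- Two linear maps on the twisted group algebra agree if they agree on the basis `x_s`. -/
lemma hom_ext {M : Type*} [AddCommMonoid M] [Module k M] {f g : α.TwistedGroupAlgebra →ₗ[k] M}
    (h : ∀ s, f (x α s) = g (x α s)) : f = g :=
  (basis α).ext h

lemma mulMap_one (a : α.TwistedGroupAlgebra) : mulMap α a 1 = a := by
  have : (mulMap α).flip 1 = LinearMap.id := by
    refine hom_ext α fun s => ?_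
    rw [LinearMap.flip_apply, one_def, map_smul, ← mul_def, x_mul_x, mul_one, toFun_one_right α s,
      smul_smul, ← Units.val_mul, inv_mul_cancel, Units.val_one, one_smul, LinearMap.id_apply]
  exact LinearMap.congr_fun this a

lemma one_mulMap (a : α.TwistedGroupAlgebra) : mulMap α 1 a = a := by
  have : mulMap α 1 = LinearMap.id := by
    refine hom_ext α fun s => ?_
    rw [one_def, map_smul, LinearMap.smul_apply, ← mul_def, x_mul_x, one_mul, toFun_one_left α s,
      smul_smul, ← Units.val_mul, inv_mul_cancel, Units.val_one, one_smul, LinearMap.id_apply]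
  exact LinearMap.congr_fun this a

lemma mulMap_assoc (a b c : α.TwistedGroupAlgebra) :
    mulMap α (mulMap α a b) c = mulMap α a (mulMap α b c) := by
  have : (mulMap α).compr₂ (mulMap α) =
      ((LinearMap.llcomp k _ _ _).flip ∘ₗ mulMap α).flip ∘ₗ mulMap α := by
    refine hom_ext α fun s => hom_ext α fun t => hom_ext α fun u => ?_
    change x α s * x α t * x α u = x α s * (x α t * x α u)
    simp only [x_mul_x]
    rw [mul_def, map_smul, LinearMap.smul_apply, mul_def, map_smul, ← mul_def, ← mul_def,
      x_mul_x, x_mul_x, smul_smul, smul_smul, ← Units.val_mul, ← Units.val_mul, α.cocycle,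
      mul_assoc]
  exact LinearMap.congr_fun (LinearMap.congr_fun (LinearMap.congr_fun this a) b) c

instance : Ring α.TwistedGroupAlgebra :=
  { (inferInstance : AddCommGroup α.TwistedGroupAlgebra),
    (inferInstance : Mul α.TwistedGroupAlgebra),
    (inferInstance : One α.TwistedGroupAlgebra) with
    left_distrib := fun a b c => map_add (mulMap α a) b c
    right_distrib := fun a b c => LinearMap.map_add₂ (mulMap α) a b c
    zero_mul := fun a => LinearMap.map_zero₂ (mulMap α) a
    mul_zero := fun a => map_zero (mulMap α a)
    mul_assoc := mulMap_assoc α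
    one_mul := one_mulMap α
    mul_one := mulMap_one α }

instance : Algebra k α.TwistedGroupAlgebra :=
  Algebra.ofModule (fun r a b => LinearMap.map_smul₂ (mulMap α) r a b)
    (fun r a b => map_smul (mulMap α a) r b)

/-- The basis vector `x_s` as a unit of the twisted group algebra. -/
def xUnit (s : S) : (α.TwistedGroupAlgebra)ˣ where
  val := x α s
  inv := ((α.toFun s s⁻¹ * α.toFun 1 1)⁻¹ : kˣ).val • x α s⁻¹
  val_inv := by
    rw [mul_smul_comm, x_mul_x, mul_inv_cancel, one_def, smul_smul, ← Units.val_mul,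
      mul_inv_rev, mul_assoc, inv_mul_cancel, mul_one]
  inv_val := by
    rw [smul_mul_assoc, x_mul_x, inv_mul_cancel, one_def, smul_smul, ← Units.val_mul,
      toFun_inv_comm, mul_inv_rev, mul_assoc, inv_mul_cancel, mul_one]

/-- The action `s ▷ b = x_s b x_s⁻¹` of `S` on the twisted group algebra. -/
def conj (s : S) (b : α.TwistedGroupAlgebra) : α.TwistedGroupAlgebra :=
  (xUnit α s : α.TwistedGroupAlgebra) * b * ((xUnit α s)⁻¹ : (α.TwistedGroupAlgebra)ˣ)

end TwistedGroupAlgebra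

end TwoCocycle

end TwistedGroupAlgebra

/-! ### The Galois object `A(G, S, α)` -/

section GaloisObject

variable {k G : Type*} [Field k] [Group G] {S : Subgroup G}

open TwoCocycle.TwistedGroupAlgebra in
/-- The algebra `A(G, S, α)` of functions `f : G → k_α S` with `f(s g) = s ▷ f(g)` for all
`s ∈ S`, `g ∈ G`, with pointwise operations. -/
def galoisObject (α : TwoCocycle S k) : Subalgebra k (G → α.TwistedGroupAlgebra) where
  carrier := {f | ∀ (s : S) (g : G), f (s * g) = conj α s (f g)}
  mul_mem' := fun {a b} ha hb s g => by
    rw [Pi.mul_apply, Pi.mul_apply, ha, hb]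
    simp only [conj, mul_assoc, Units.inv_mul_cancel_left]
  add_mem' := fun {a b} ha hb s g => by
    rw [Pi.add_apply, Pi.add_apply, ha, hb]
    simp only [conj, mul_add, add_mul]
  algebraMap_mem' := fun r s g => by
    simp only [Pi.algebraMap_apply, conj]
    rw [← Algebra.commutes, mul_assoc, Units.mul_inv, mul_one]

variable (α : TwoCocycle S k)

/-- The action `(g.f)(h) = f(h g)` of `G` on `A(G, S, α)`. -/
instance : SMul G (galoisObject α) where
  smul g f := ⟨fun h => f.1 (h * g), fun s h => by
    have := f.2 s (h * g)
    rwa [← mul_assoc] at this⟩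

lemma galoisObject_smul_apply (g h : G) (f : galoisObject α) : (g • f).1 h = f.1 (h * g) := rfl

instance : MulSemiringAction G (galoisObject α) where
  one_smul f := Subtype.ext <| funext fun h => by rw [galoisObject_smul_apply, mul_one]
  mul_smul g g' f := Subtype.ext <| funext fun h => by
    simp only [galoisObject_smul_apply, mul_assoc]
  smul_zero _ := rfl
  smul_add _ _ _ := rfl
  smul_one _ := rfl
  smul_mul _ _ _ := rfl

instance : SMulCommClass G k (galoisObject α) where
  smul_comm _ _ _ := rfl

end GaloisObject

/-! ### Twists of group algebras -/

section GroupTwist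

open Module

variable {k G : Type*} [Field k] [Group G]

/-- The multiplication of the crossed product `(k^G)^{(J)}`: the space `k^G = (kG)*` with
`(f f')(x) = (f ⊗ f')(J Δ(x))`, that is, `f f' = J(f₁, f'₁) f₂ f'₂`. -/
def crossedMul (J : HopfTwist k (MonoidAlgebra k G)) (f f' : Dual k (MonoidAlgebra k G)) :
    Dual k (MonoidAlgebra k G) :=
  TensorProduct.dualDistrib k _ _ (f ⊗ₜ[k] f') ∘ₗ
    LinearMap.mulLeft k (J.val : MonoidAlgebra k G ⊗[k] MonoidAlgebra k G) ∘ₗ Coalgebra.comul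

/-- The twist `J` corresponds to the `G`-algebra `A`, if `A` is isomorphic to the crossed product
`(k^G)^{(J)}` as a `k^G`-comodule algebra, that is, as an algebra with `G`-action, where `G` acts
on `k^G = (kG)*` by `(g.f)(x) = f(x g)`. -/
def HopfTwist.CorrespondsTo (J : HopfTwist k (MonoidAlgebra k G)) (A : Type*) [Ring A]
    [Algebra k A] [MulSemiringAction G A] : Prop :=
  ∃ e : A ≃ₗ[k] Dual k (MonoidAlgebra k G),
    e 1 = Coalgebra.counit ∧
    (∀ a b : A, e (a * b) = crossedMul J (e a) (e b)) ∧
    ∀ (g : G) (a : A) (x : MonoidAlgebra k G),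
      e (g • a) x = e a (x * MonoidAlgebra.single g 1)

/-- The subalgebra `kF ⊗ kF` of `kG ⊗ kG`, for a subgroup `F` of `G`. -/
def subgroupTensor (k : Type*) {G : Type*} [Field k] [Group G] (F : Subgroup G) :
    Subalgebra k (MonoidAlgebra k G ⊗[k] MonoidAlgebra k G) :=
  (Algebra.TensorProduct.map (MonoidAlgebra.mapDomainAlgHom k k F.subtype)
    (MonoidAlgebra.mapDomainAlgHom k k F.subtype)).range

/-- The quotient map `(kG)^J → k(G/F)^{J̄}`, where `J̄` is the image of `J` under `kG → k(G/F)`. -/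
def twistedQuotient (J : HopfTwist k (MonoidAlgebra k G)) (F : Subgroup G) [F.Normal] :
    J.Twisted →ₐc[k] (J.map (MonoidAlgebra.mapDomainBialgHom k (QuotientGroup.mk' F))).Twisted :=
  J.twistedMap (MonoidAlgebra.mapDomainBialgHom k (QuotientGroup.mk' F))

end GroupTwist

end

/-! Everything on the group side rests on averaging in `k_α S`. For `t ≠ 1`, non-degeneracy gives
some `r` commuting with `t` for which `x_r x_t x_r⁻¹` is a nontrivial multiple of `x_t`, so `∑ s,
x_s x_t x_s⁻¹ = 0`; hence conjugation-invariant elements are scalars. Spreading the Casimir element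
`∑ x_q ⊗ x_q⁻¹` over the cosets of `S` gives explicit preimages of `1 ⊗ e_g` under `can`, so `A` is
a Galois object, and turns the Miyashita–Ulbrich action into a rescaling of components: `(a ↼ h)(u)
= ∑ s, h(u⁻¹su) a(u)_s x_s` (`miyashitaUlbrich_apply`).

If `S ≤ F`, normality of `F` makes each value of an `F`-invariant function conjugation-invariant,
hence scalar, and `h` acts on `A^F` as `h(1)`. Conversely, suppose that `A^F` is stable. If for some
`t ≠ 1` the sum `∑ x_n x_t x_n⁻¹` over `n ∈ S ∩ F` has a nonzero `x_t`-component, stability forces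
`F` to centralize `t`. Prime index and trivial center then give `C_G(t) = F`, so the sum runs over
`C_S(t)`; elements of `S` outside `C_S(t)` contribute nothing to the `x_t`-component, which
therefore equals that of the full average, namely zero. So all these components vanish, and a double
count of `∑ x_n x_t x_n⁻¹ x_t⁻¹` yields `|S ∩ F| = |S|`.

On the Hopf side, let `K = (kG)^J`. The isomorphism `A ≅ (kG)*` makes `A` a right `K`-module algebra
with action commuting with `G`, and identifies `A^F` with the image of the dual of the quotient. The
element `h^[1] ⊗ h^[2]` is `K`-invariant because `can` is `K`-linear, and so `(h^[1] x h^[2])·y =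
h^[1] (x·y₂) (h^[2]·S(y₁)y₃)`. The coadjoint coaction on the right is dual to the right adjoint
action of `K*`, so conormality implies stability of `A^F`.

The equivalences form a cycle: conormal, then stable, then `S ≤ F`, then `J ∈ kF ⊗ kF` because `J ∈
kS ⊗ kS`, then conormal again, since for such `J` the dual of the quotient is central in `K*`. -/

noncomputable section

/-! ### Conjugation, averaging and the Casimir element in a twisted group algebra. -/

section TwistedGroupAlgebraConjugation

namespace TwoCocycle

namespace TwistedGroupAlgebra

variable {S k : Type*} [Group S] [Field k] (α : TwoCocycle S k)

@[simp] lemma val_xUnit (s : S) : (xUnit α s : α.TwistedGroupAlgebra) = x α s := rfl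

lemma x_mul_eq (s t : S) :
    x α (s * t) = ((α.toFun s t)⁻¹ : kˣ).val • (x α s * x α t) := by
  rw [x_mul_x, smul_smul, ← Units.val_mul, inv_mul_cancel, Units.val_one, one_smul]

lemma x_one : x α 1 = (α.toFun 1 1 : k) • (1 : α.TwistedGroupAlgebra) := by
  rw [one_def, smul_smul, ← Units.val_mul, mul_inv_cancel, Units.val_one, one_smul]

lemma x_ne_zero (s : S) : x α s ≠ 0 := (basis α).ne_zero s

instance : Nontrivial α.TwistedGroupAlgebra := ⟨x α 1, 0, x_ne_zero α 1⟩

lemma repr_x [DecidableEq S] (s t : S) :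
    (basis α).repr (x α s) t = if s = t then 1 else 0 := by
  rw [x, Module.Basis.repr_self, Finsupp.single_apply]

/-- Conjugation by `x_s` as a linear map. -/
def conjLinear (s : S) : α.TwistedGroupAlgebra →ₗ[k] α.TwistedGroupAlgebra :=
  LinearMap.mulRight k (((xUnit α s)⁻¹ : (α.TwistedGroupAlgebra)ˣ) : α.TwistedGroupAlgebra) ∘ₗ
    LinearMap.mulLeft k (x α s)

@[simp] lemma conjLinear_apply (s : S) (b : α.TwistedGroupAlgebra) :
    conjLinear α s b = conj α s b := rfl

lemma conj_eq_iff (s : S) (b c : α.TwistedGroupAlgebra) :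
    conj α s b = c ↔ x α s * b = c * x α s :=
  Units.mul_inv_eq_iff_eq_mul _

lemma conj_mul_x (s : S) (b : α.TwistedGroupAlgebra) : conj α s b * x α s = x α s * b :=
  ((conj_eq_iff α s b _).1 rfl).symm

lemma conj_one_right (s : S) : conj α s 1 = 1 := by simp [conj_eq_iff]

lemma conj_one_left (b : α.TwistedGroupAlgebra) : conj α 1 b = b := by
  rw [conj_eq_iff, x_one, smul_mul_assoc, mul_smul_comm, one_mul, mul_one]

lemma conj_mul_right (s : S) (b c : α.TwistedGroupAlgebra) :
    conj α s (b * c) = conj α s b * conj α s c := by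
  simp only [conj, mul_assoc, Units.inv_mul_cancel_left]

lemma conj_mul_left (s t : S) (b : α.TwistedGroupAlgebra) :
    conj α (s * t) b = conj α s (conj α t b) := by
  rw [conj_eq_iff, x_mul_eq, smul_mul_assoc, mul_smul_comm, ← mul_assoc, conj_mul_x, mul_assoc,
    mul_assoc, conj_mul_x]

lemma conj_smul (s : S) (c : k) (b : α.TwistedGroupAlgebra) :
    conj α s (c • b) = c • conj α s b := map_smul (conjLinear α s) c b

lemma conj_inv_eq_iff (s : S) (b c : α.TwistedGroupAlgebra) :
    conj α s⁻¹ b = c ↔ b = conj α s c := by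
  constructor
  · rintro rfl
    rw [← conj_mul_left, mul_inv_cancel, conj_one_left]
  · rintro rfl
    rw [← conj_mul_left, inv_mul_cancel, conj_one_left]

/-- `x_s x_t x_s⁻¹` is a multiple of `x_{sts⁻¹}`. -/
lemma exists_conj_x (s t : S) : ∃ c : k, conj α s (x α t) = c • x α (s * t * s⁻¹) := by
  refine ⟨((α.toFun (s * t * s⁻¹) s)⁻¹ * α.toFun s t : kˣ), ?_⟩
  rw [conj_eq_iff, smul_mul_assoc, x_mul_x, x_mul_x, inv_mul_cancel_right, smul_smul,
    ← Units.val_mul, mul_right_comm, inv_mul_cancel, one_mul]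

lemma conj_x_of_commute {s t : S} (h : s * t = t * s) :
    conj α s (x α t) = (α.toFun s t * (α.toFun t s)⁻¹ : kˣ).val • x α t := by
  rw [conj_eq_iff, smul_mul_assoc, x_mul_x, x_mul_x, h, smul_smul, ← Units.val_mul,
    inv_mul_cancel_right]

lemma conj_inv_left (s : S) (b : α.TwistedGroupAlgebra) :
    conj α s⁻¹ b =
      (((xUnit α s)⁻¹ : (α.TwistedGroupAlgebra)ˣ) : α.TwistedGroupAlgebra) * b * x α s := by
  rw [conj_inv_eq_iff, conj, val_xUnit]
  simp only [mul_assoc, ← val_xUnit α s, Units.mul_inv, Units.mul_inv_cancel_left, mul_one]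

lemma repr_one_smul_x_one : (basis α).repr 1 1 • x α 1 = 1 := by
  classical
  rw [one_def, map_smul, Finsupp.smul_apply, repr_x, if_pos rfl, smul_eq_mul, mul_one]

lemma repr_one_of_ne {s : S} (hs : s ≠ 1) : (basis α).repr 1 s = 0 := by
  classical
  rw [one_def, map_smul, Finsupp.smul_apply, repr_x, if_neg (Ne.symm hs), smul_zero]

section Fintype

variable [Fintype S]

/-- The map `b ↦ ∑ s, x_s b x_s⁻¹`. -/
def sumConj : α.TwistedGroupAlgebra →ₗ[k] α.TwistedGroupAlgebra := ∑ s, conjLinear α s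

lemma sumConj_apply (b : α.TwistedGroupAlgebra) : sumConj α b = ∑ s, conj α s b := by
  simp [sumConj]

lemma sumConj_one : sumConj α 1 = (Fintype.card S : k) • (1 : α.TwistedGroupAlgebra) := by
  simp [sumConj_apply, conj_one_right, Nat.cast_smul_eq_nsmul]

lemma sumConj_conj (t : S) (b : α.TwistedGroupAlgebra) :
    sumConj α (conj α t b) = sumConj α b := by
  simp only [sumConj_apply, ← conj_mul_left]
  exact Equiv.sum_comp (Equiv.mulRight t) fun s => conj α s b

lemma conj_sumConj (t : S) (b : α.TwistedGroupAlgebra) :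
    conj α t (sumConj α b) = sumConj α b := by
  rw [← conjLinear_apply, sumConj_apply, map_sum]
  simp only [conjLinear_apply, ← conj_mul_left]
  exact Equiv.sum_comp (Equiv.mulLeft t) fun s => conj α s b

variable {α} in
/-- For a non-degenerate cocycle the elements `x_t`, `t ≠ 1`, average to zero. -/
lemma sumConj_x (hα : α.IsNondegenerate) {t : S} (ht : t ≠ 1) : sumConj α (x α t) = 0 := by
  have h : ¬ α.IsRegular t := fun h => ht ((hα t).1 h)
  simp only [IsRegular, not_forall] at h
  obtain ⟨r, hr, hne⟩ := h
  -- Conjugation by `x_r` leaves the average unchanged but multiplies `x_t` by `α(r,t)/α(t,r) ≠ 1`.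
  have h1 := sumConj_conj α r (x α t)
  rw [conj_x_of_commute α hr.symm, map_smul] at h1
  by_contra h0
  have h2 : (α.toFun r t * (α.toFun t r)⁻¹ : kˣ).val = 1 := by
    have h3 : ((α.toFun r t * (α.toFun t r)⁻¹ : kˣ).val - 1) • sumConj α (x α t) = 0 := by
      rw [sub_smul, h1, one_smul, sub_self]
    exact sub_eq_zero.1 ((smul_eq_zero.1 h3).resolve_right h0)
  rw [Units.val_eq_one, mul_inv_eq_one] at h2
  exact hne h2.symm

variable {α} in
-- Only the `x_1`-component survives averaging, and `x_1`, being a multiple of the unit, is fixed by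
-- all `|S|` conjugations.
lemma sumConj_eq (hα : α.IsNondegenerate) (b : α.TwistedGroupAlgebra) :
    sumConj α b = ((Fintype.card S : k) * (basis α).repr b 1) • x α 1 := by
  classical
  let L : α.TwistedGroupAlgebra →ₗ[k] α.TwistedGroupAlgebra :=
    (Fintype.card S : k) • ((basis α).coord 1).smulRight (x α 1)
  have : sumConj α = L := by
    refine hom_ext α fun t => ?_
    by_cases ht : t = 1
    · subst ht
      simp only [L, LinearMap.smul_apply, LinearMap.smulRight_apply, Module.Basis.coord_apply,
        repr_x, if_true, one_smul]
      rw [x_one, map_smul, sumConj_one, smul_comm]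
    · simp [L, sumConj_x hα ht, repr_x, ht]
  rw [this]
  simp [L, smul_smul]

variable {α} in
/-- The projection to the line spanned by `x_t` expressed by averaging. -/
lemma sumConj_mul_inv (hα : α.IsNondegenerate) (b : α.TwistedGroupAlgebra) (t : S) :
    sumConj α (b * (((xUnit α t)⁻¹ : (α.TwistedGroupAlgebra)ˣ) : α.TwistedGroupAlgebra)) * x α t =
      ((Fintype.card S : k) * (basis α).repr b t) • x α t := by
  classical
  let u : α.TwistedGroupAlgebra := (((xUnit α t)⁻¹ : (α.TwistedGroupAlgebra)ˣ) : _)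
  let L : α.TwistedGroupAlgebra →ₗ[k] α.TwistedGroupAlgebra :=
    LinearMap.mulRight k (x α t) ∘ₗ sumConj α ∘ₗ LinearMap.mulRight k u
  let M : α.TwistedGroupAlgebra →ₗ[k] α.TwistedGroupAlgebra :=
    (Fintype.card S : k) • ((basis α).coord t).smulRight (x α t)
  have : L = M := by
    refine hom_ext α fun s => ?_
    simp only [L, M, LinearMap.comp_apply, LinearMap.mulRight_apply, LinearMap.smul_apply,
      LinearMap.smulRight_apply, Module.Basis.coord_apply, repr_x]
    by_cases hs : s = t
    · subst hs
      have : x α s * u = 1 := (xUnit α s).mul_inv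
      rw [this, sumConj_one, if_pos rfl, one_smul, smul_mul_assoc, one_mul]
    -- For `s ≠ t` the product `x_s x_t⁻¹` is a multiple of `x_{st⁻¹}`, which averages to zero.
    · have h1 : u = ((α.toFun t t⁻¹ * α.toFun 1 1)⁻¹ : kˣ).val • x α t⁻¹ := rfl
      rw [h1, mul_smul_comm, x_mul_x, map_smul, map_smul,
        sumConj_x hα (mul_inv_eq_one.not.2 hs), if_neg hs]
      simp
  have h := LinearMap.congr_fun this b
  simpa [L, M, smul_smul] using h

variable {α} in
lemma repr_sumConj_x_self (hα : α.IsNondegenerate) {t : S} (ht : t ≠ 1) :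
    ∑ s, (basis α).repr (conj α s (x α t)) t = 0 := by
  have h := congrArg (fun b => (basis α).repr b t) (sumConj_x hα ht)
  simpa [sumConj_apply] using h

/-- The Casimir element `∑ s, x_s ⊗ x_s⁻¹` of the twisted group algebra. -/
def casimir : α.TwistedGroupAlgebra ⊗[k] α.TwistedGroupAlgebra :=
  ∑ s, x α s ⊗ₜ[k] (((xUnit α s)⁻¹ : (α.TwistedGroupAlgebra)ˣ) : α.TwistedGroupAlgebra)

/-- For `b = x_t`, substitute `s ↦ ts`: the factor `α(t,s)` produced by `x_t x_s` on the left is the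
one produced by `x_{ts}⁻¹ x_t` on the right. -/
lemma map_mulLeft_casimir (b : α.TwistedGroupAlgebra) :
    (LinearMap.mulLeft k b).rTensor α.TwistedGroupAlgebra (casimir α) =
      (LinearMap.mulRight k b).lTensor α.TwistedGroupAlgebra (casimir α) := by
  let L : α.TwistedGroupAlgebra →ₗ[k] α.TwistedGroupAlgebra ⊗[k] α.TwistedGroupAlgebra :=
    LinearMap.flip (LinearMap.rTensorHom α.TwistedGroupAlgebra ∘ₗ LinearMap.mul k _) (casimir α)
  let M : α.TwistedGroupAlgebra →ₗ[k] α.TwistedGroupAlgebra ⊗[k] α.TwistedGroupAlgebra :=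
    LinearMap.flip (LinearMap.lTensorHom α.TwistedGroupAlgebra ∘ₗ (LinearMap.mul k _).flip)
      (casimir α)
  have : L = M := by
    refine hom_ext α fun t => ?_
    change (LinearMap.mulLeft k (x α t)).rTensor α.TwistedGroupAlgebra (casimir α) =
      (LinearMap.mulRight k (x α t)).lTensor α.TwistedGroupAlgebra (casimir α)
    simp only [casimir, map_sum, LinearMap.rTensor_tmul, LinearMap.lTensor_tmul,
      LinearMap.mulLeft_apply, LinearMap.mulRight_apply]
    refine Fintype.sum_equiv (Equiv.mulLeft t) _ _ fun s => ?_
    have h : ((xUnit α (t * s))⁻¹ : (α.TwistedGroupAlgebra)ˣ).val * x α t =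
        (α.toFun t s : k) • ((xUnit α s)⁻¹ : (α.TwistedGroupAlgebra)ˣ).val := by
      rw [Units.inv_mul_eq_iff_eq_mul, mul_smul_comm, val_xUnit, ← smul_mul_assoc, ← x_mul_x,
        mul_assoc, ← val_xUnit α s, Units.mul_inv, mul_one]
    rw [Equiv.coe_mulLeft, h, x_mul_x, TensorProduct.smul_tmul]
  exact LinearMap.congr_fun this b

end Fintype

end TwistedGroupAlgebra

end TwoCocycle

end TwistedGroupAlgebraConjugation

/-! ### The algebra `A(G, S, α)`: functions supported on one coset, canonical map, Miyashita–Ulbrich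
action. -/

section GaloisObjectStructure

open TwoCocycle TwoCocycle.TwistedGroupAlgebra

variable {k G : Type*} [Field k] [Group G] {S : Subgroup G} (α : TwoCocycle S k)

namespace galoisObject

@[ext] lemma ext' {a b : galoisObject α} (h : ∀ u, a.1 u = b.1 u) : a = b :=
  Subtype.ext (funext h)

lemma mul_apply (a b : galoisObject α) (u : G) : (a * b).1 u = a.1 u * b.1 u := rfl

lemma one_apply (u : G) : (1 : galoisObject α).1 u = 1 := rfl

/-- Evaluation at an element of the group. -/
def eval (u : G) : galoisObject α →ₗ[k] α.TwistedGroupAlgebra :=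
  LinearMap.proj u ∘ₗ (galoisObject α).toSubmodule.subtype

lemma eval_apply (u : G) (a : galoisObject α) : eval α u a = a.1 u := rfl

lemma sum_apply {ι : Type*} (s : Finset ι) (f : ι → galoisObject α) (u : G) :
    (∑ i ∈ s, f i).1 u = ∑ i ∈ s, (f i).1 u :=
  map_sum (eval α u) f s

open Classical in
/-- The value at `u` of the function supported on `S r` with value `b` at `r`, as a function
of `b`. -/
def extendAt (r u : G) : α.TwistedGroupAlgebra →ₗ[k] α.TwistedGroupAlgebra :=
  if h : u * r⁻¹ ∈ S then conjLinear α ⟨u * r⁻¹, h⟩ else 0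

lemma extendAt_mul (r u : G) (s : S) (b : α.TwistedGroupAlgebra) :
    extendAt α r (s * u) b = conj α s (extendAt α r u b) := by
  by_cases h : u * r⁻¹ ∈ S
  · have h' : s * u * r⁻¹ ∈ S := by rw [mul_assoc]; exact S.mul_mem s.2 h
    rw [extendAt, extendAt, dif_pos h, dif_pos h', conjLinear_apply, conjLinear_apply,
      ← conj_mul_left]
    congr 1
    exact Subtype.ext (mul_assoc _ _ _)
  · have h' : s * u * r⁻¹ ∉ S := by rwa [mul_assoc, S.mul_mem_cancel_left s.2]
    rw [extendAt, extendAt, dif_neg h, dif_neg h', LinearMap.zero_apply, ← conjLinear_apply,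
      map_zero]

/-- The function supported on the coset `S r` which takes the value `b` at `r`. -/
def extend (r : G) : α.TwistedGroupAlgebra →ₗ[k] galoisObject α where
  toFun b := ⟨fun u => extendAt α r u b, fun s u => extendAt_mul α r u s b⟩
  map_add' b c := ext' α fun u => map_add (extendAt α r u) b c
  map_smul' c b := ext' α fun u => map_smul (extendAt α r u) c b

lemma extend_apply (r u : G) (b : α.TwistedGroupAlgebra) :
    (extend α r b).1 u = extendAt α r u b := rfl

lemma extend_apply_mul (r : G) (s : S) (b : α.TwistedGroupAlgebra) :
    (extend α r b).1 (s * r) = conj α s b := by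
  have h : (s : G) * r * r⁻¹ ∈ S := by rw [mul_inv_cancel_right]; exact s.2
  rw [extend_apply, extendAt, dif_pos h, conjLinear_apply]
  congr 1
  exact Subtype.ext (mul_inv_cancel_right _ _)

lemma extend_apply_of_eq {r u : G} (s : S) (h : u = s * r) (b : α.TwistedGroupAlgebra) :
    (extend α r b).1 u = conj α s b := by
  rw [h, extend_apply_mul]

lemma extend_apply_of_notMem {r u : G} (h : u * r⁻¹ ∉ S) (b : α.TwistedGroupAlgebra) :
    (extend α r b).1 u = 0 := by
  rw [extend_apply, extendAt, dif_neg h, LinearMap.zero_apply]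

lemma mul_extend (a : galoisObject α) (r : G) (b : α.TwistedGroupAlgebra) :
    a * extend α r b = extend α r (a.1 r * b) := by
  ext u
  rw [mul_apply]
  by_cases h : u * r⁻¹ ∈ S
  · have hu : u = (⟨u * r⁻¹, h⟩ : S) * r := by simp
    rw [extend_apply_of_eq α _ hu, extend_apply_of_eq α _ hu, conj_mul_right]
    congr 1
    conv_lhs => rw [hu]
    exact a.2 _ _
  · rw [extend_apply_of_notMem α h, extend_apply_of_notMem α h, mul_zero]

lemma extend_mul (a : galoisObject α) (r : G) (b : α.TwistedGroupAlgebra) :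
    extend α r b * a = extend α r (b * a.1 r) := by
  ext u
  rw [mul_apply]
  by_cases h : u * r⁻¹ ∈ S
  · have hu : u = (⟨u * r⁻¹, h⟩ : S) * r := by simp
    rw [extend_apply_of_eq α _ hu, extend_apply_of_eq α _ hu, conj_mul_right]
    congr 1
    conv_lhs => rw [hu]
    exact a.2 _ _
  · rw [extend_apply_of_notMem α h, extend_apply_of_notMem α h, zero_mul]

variable [Fintype G] [Fintype S]

/-- A sum over the group of a function supported on the coset `S u`. -/
lemma sum_eq_sum_subgroup {M : Type*} [AddCommMonoid M] (u : G) (φ : G → M)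
    (h : ∀ r, u * r⁻¹ ∉ S → φ r = 0) : ∑ r, φ r = ∑ s : S, φ ((s : G)⁻¹ * u) := by
  refine (Fintype.sum_of_injective (fun s : S => (s : G)⁻¹ * u) ?_ _ _ ?_ fun _ => rfl).symm
  · intro s t hst
    simpa using hst
  · intro r hr
    refine h r fun hmem => hr ⟨⟨_, hmem⟩, ?_⟩
    simp

/-- Exactly the points `r = s⁻¹u` contribute, each with `x_s b x_s⁻¹`. -/
lemma sum_extend_apply (u : G) (b : α.TwistedGroupAlgebra) :
    ∑ r, (extend α r b).1 u = sumConj α b := by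
  rw [sum_eq_sum_subgroup (S := S) u _ fun r hr => extend_apply_of_notMem α hr b, sumConj_apply]
  refine Finset.sum_congr rfl fun s _ => extend_apply_of_eq α s ?_ b
  rw [mul_inv_cancel_left]

variable {α} in
open Classical in
-- The one computation behind both uses of the Casimir element: `y = 1`, `u' = u g'` computes the
-- canonical map, while `y = a(u)`, `u' = u` computes the Miyashita–Ulbrich action. The two supports
-- meet only if `ug = tu'` with `t ∈ S`. Then, for each of the `|S|` admissible `r`, the sum over
-- `q` is an average of `y x_t⁻¹` followed by `x_t`, which isolates the `x_t`-component of `y`.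
lemma sum_sum_extend_mul_mul (hα : α.IsNondegenerate) (g u u' : G)
    (y : α.TwistedGroupAlgebra) :
    ∑ r, ∑ q, (extend α r (x α q)).1 u * y *
      (extend α (r * g) ((xUnit α q)⁻¹ : (α.TwistedGroupAlgebra)ˣ).val).1 u' =
    ((Fintype.card S : k) ^ 2) • if h : u * g * u'⁻¹ ∈ S then
      (basis α).repr y ⟨u * g * u'⁻¹, h⟩ • x α ⟨u * g * u'⁻¹, h⟩ else 0 := by
  rw [sum_eq_sum_subgroup (S := S) u _ fun r hr => Finset.sum_eq_zero fun q _ => by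
    rw [extend_apply_of_notMem α hr, zero_mul, zero_mul]]
  split_ifs with h
  · set t : S := ⟨u * g * u'⁻¹, h⟩ with ht
    have hs : ∀ s : S, ∑ q, (extend α ((s : G)⁻¹ * u) (x α q)).1 u * y *
        (extend α ((s : G)⁻¹ * u * g) ((xUnit α q)⁻¹ : (α.TwistedGroupAlgebra)ˣ).val).1 u' =
        ((Fintype.card S : k) * (basis α).repr y t) • x α t := by
      intro s
      have e1 : ∀ q, (extend α ((s : G)⁻¹ * u) (x α q)).1 u = conj α s (x α q) := fun q =>
        extend_apply_of_eq α s (by rw [mul_inv_cancel_left]) _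
      -- Here `u' = t⁻¹ug = (t⁻¹s)(s⁻¹ug)`, so the value is `c` conjugated by `t⁻¹s`.
      have e2 : ∀ c, (extend α ((s : G)⁻¹ * u * g) c).1 u' =
          ((xUnit α t)⁻¹ : (α.TwistedGroupAlgebra)ˣ).val * conj α s c * x α t := fun c => by
        rw [← conj_inv_left, ← conj_mul_left]
        refine extend_apply_of_eq α _ ?_ _
        simp [ht, mul_assoc]
      -- The average does not change when its terms are replaced by conjugation by `x_s x_q x_s⁻¹`;
      -- this matches the factors `conj s (x_q)` coming from `e1` and `e2`.
      rw [← sumConj_mul_inv hα, ← sumConj_conj α s⁻¹, ← conj_sumConj α s, sumConj_apply,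
        ← conjLinear_apply, map_sum, Finset.sum_mul]
      refine Finset.sum_congr rfl fun q _ => ?_
      have e3 : ∀ z, conj α s (conj α q (conj α s⁻¹ z)) = conj α s (x α q) * z *
          conj α s ((xUnit α q)⁻¹ : (α.TwistedGroupAlgebra)ˣ).val := fun z => by
        rw [show conj α q (conj α s⁻¹ z) = x α q * conj α s⁻¹ z *
          ((xUnit α q)⁻¹ : (α.TwistedGroupAlgebra)ˣ).val from rfl, conj_mul_right, conj_mul_right,
          ← (conj_inv_eq_iff α s z _).1 rfl]
      rw [e1, e2, conjLinear_apply, e3]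
      simp only [mul_assoc]
    rw [Finset.sum_congr rfl fun s _ => hs s, Finset.sum_const, Finset.card_univ,
      ← Nat.cast_smul_eq_nsmul k, smul_smul, smul_smul, pow_two, mul_assoc]
  · rw [smul_zero]
    refine Finset.sum_eq_zero fun s _ => Finset.sum_eq_zero fun q _ => ?_
    rw [extend_apply_of_notMem α (r := (s : G)⁻¹ * u * g), mul_zero]
    intro h'
    apply h
    have := S.inv_mem (S.mul_mem h' (S.inv_mem s.2))
    simpa [mul_assoc] using this

/-- The preimage of `1 ⊗ e_g` under the canonical map. -/
def canPreimageSingle (g : G) : galoisObject α ⊗[k] galoisObject α :=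
  -- One factor `|S|` compensates for summing over all `r` instead of coset representatives, the
  -- other for the unnormalized average over `q`.
  ((Fintype.card S : k) ^ 2)⁻¹ •
    ∑ r, TensorProduct.map (extend α r) (extend α (r * g)) (casimir α)

lemma canPreimageSingle_eq (g : G) : canPreimageSingle α g = ((Fintype.card S : k) ^ 2)⁻¹ •
    ∑ r, ∑ q, extend α r (x α q) ⊗ₜ[k]
      extend α (r * g) ((xUnit α q)⁻¹ : (α.TwistedGroupAlgebra)ˣ).val := by
  simp [canPreimageSingle, casimir]

/-- The preimage of `1 ⊗ h` under the canonical map. -/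
def canPreimage : (G → k) →ₗ[k] galoisObject α ⊗[k] galoisObject α :=
  ∑ g, (LinearMap.proj g).smulRight (canPreimageSingle α g)

lemma canPreimage_apply (h : G → k) :
    canPreimage α h = ∑ g, h g • canPreimageSingle α g := by
  simp [canPreimage]

lemma canPreimage_single [DecidableEq G] (g : G) :
    canPreimage α (Pi.single g 1) = canPreimageSingle α g := by
  rw [canPreimage_apply, Finset.sum_eq_single g] <;> simp +contextual

end galoisObject

/-! ### The canonical map of an arbitrary `G`-algebra, in components `a ⊗ b ↦ a (g.b)`. -/

section Can

variable {A : Type*} [Ring A] [Algebra k A] [MulSemiringAction G A] [SMulCommClass G k A]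

variable (k A) in
/-- The map `a ⊗ b ↦ a (g.b)`. -/
def mulSMul (g : G) : A ⊗[k] A →ₗ[k] A :=
  LinearMap.mul' k A ∘ₗ (DistribSMul.toLinearMap k A g).lTensor A

@[simp] lemma mulSMul_tmul (g : G) (a b : A) : mulSMul k A g (a ⊗ₜ b) = a * g • b := rfl

variable [Fintype G] [DecidableEq G]

lemma galoisCoaction_apply (a : A) :
    galoisCoaction k G A a = ∑ g : G, (g • a) ⊗ₜ[k] (Pi.single g 1 : G → k) := by
  simp [galoisCoaction]

lemma galoisCan_apply (z : A ⊗[k] A) :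
    galoisCan k G A z = ∑ g : G, mulSMul k A g z ⊗ₜ[k] (Pi.single g 1 : G → k) := by
  induction z with
  | zero => simp
  | add a b ha hb => simp only [map_add, ha, hb, TensorProduct.add_tmul, Finset.sum_add_distrib]
  | tmul a b =>
    simp [galoisCan, galoisCoaction_apply, TensorProduct.tmul_sum]

lemma galoisCan_mulLeft (a : A) (z : A ⊗[k] A) :
    galoisCan k G A ((LinearMap.mulLeft k a).rTensor A z) =
      (LinearMap.mulLeft k a).rTensor (G → k) (galoisCan k G A z) := by
  simp only [galoisCan_apply, map_sum, LinearMap.rTensor_tmul]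
  refine Finset.sum_congr rfl fun g _ => ?_
  congr 1
  induction z with
  | zero => simp
  | add a b ha hb => simp only [map_add, ha, hb]
  | tmul b c => simp [mul_assoc]

lemma sum_tmul_single_eq (f : G → A) (h : ∀ g, f g = f 1) :
    ∑ g : G, f g ⊗ₜ[k] (Pi.single g 1 : G → k) = f 1 ⊗ₜ[k] (1 : G → k) := by
  have : (1 : G → k) = ∑ g : G, Pi.single g 1 := (Finset.univ_sum_single (1 : G → k)).symm
  rw [this, TensorProduct.tmul_sum]
  exact Finset.sum_congr rfl fun g _ => by rw [h]

/-- The contraction of `A ⊗ k^G` with the evaluation at `g`. -/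
lemma rid_lTensor_proj_sum (f : G → A) (g : G) :
    TensorProduct.rid k A ((LinearMap.proj g : (G → k) →ₗ[k] k).lTensor A
      (∑ g' : G, f g' ⊗ₜ[k] (Pi.single g' 1 : G → k))) = f g := by
  simp only [map_sum, LinearMap.lTensor_tmul, LinearMap.proj_apply, TensorProduct.rid_tmul]
  rw [Finset.sum_eq_single g] <;> simp +contextual [eq_comm]

lemma galoisCoaction_eq_tmul_one_iff (a : A) :
    galoisCoaction k G A a = a ⊗ₜ[k] (1 : G → k) ↔ ∀ g : G, g • a = a := by
  rw [galoisCoaction_apply]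
  constructor
  · intro h g
    have := congrArg (fun z => TensorProduct.rid k A
      ((LinearMap.proj g : (G → k) →ₗ[k] k).lTensor A z)) h
    simpa only [rid_lTensor_proj_sum, LinearMap.lTensor_tmul, LinearMap.proj_apply,
      Pi.one_apply, TensorProduct.rid_tmul, one_smul] using this
  · intro h
    rw [sum_tmul_single_eq (fun g : G => g • a) fun g => by rw [h, h], one_smul]

lemma miyashitaUlbrich_eq (hcan : Function.Injective (galoisCan k G A)) (a : A) {h : G → k}
    {z : A ⊗[k] A} (hz : galoisCan k G A z = 1 ⊗ₜ h) :
    miyashitaUlbrich k G a h = sandwich k a z := by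
  rw [miyashitaUlbrich, ← hz, Function.leftInverse_invFun hcan]

@[simp] lemma sandwich_tmul (y a b : A) : sandwich k y (a ⊗ₜ[k] b) = a * y * b := by
  simp [sandwich, mul_assoc]

end Can

/-! ### Bijectivity of the canonical map and the formula for the Miyashita–Ulbrich action. -/

namespace galoisObject

variable [Fintype G] [Fintype S] [DecidableEq G] [CharZero k]

variable {α} in
-- By `sum_sum_extend_mul_mul` with `y = 1` and `u' = ug'`: the unit has only an `x_1`-component, so
-- `u g g'⁻¹ u⁻¹` must be `1`.
lemma mulSMul_canPreimageSingle (hα : α.IsNondegenerate) (g g' : G) :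
    mulSMul k (galoisObject α) g' (canPreimageSingle α g) = if g = g' then 1 else 0 := by
  have hc : ((Fintype.card S : k) ^ 2) ≠ 0 :=
    pow_ne_zero _ (Nat.cast_ne_zero.2 Fintype.card_ne_zero)
  ext u
  simp only [canPreimageSingle_eq, map_smul, map_sum, mulSMul_tmul]
  change ((Fintype.card S : k) ^ 2)⁻¹ • eval α u _ = _
  simp only [map_sum, eval_apply, mul_apply, galoisObject_smul_apply]
  have := sum_sum_extend_mul_mul hα g u (u * g') 1
  simp only [mul_one] at this
  rw [this, inv_smul_smul₀ hc]
  split_ifs with h1 h2 h2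
  · subst h2
    have : (⟨u * g * (u * g)⁻¹, h1⟩ : S) = 1 := Subtype.ext (mul_inv_cancel _)
    rw [this, repr_one_smul_x_one, one_apply]
  · rw [repr_one_of_ne, zero_smul]
    · rfl
    · intro h
      have := congrArg Subtype.val h
      simp only [Subgroup.coe_one, mul_inv_eq_one] at this
      exact h2 (mul_left_cancel this)
  · subst h2
    simp at h1
  · rfl

variable {α} in
lemma galoisCan_canPreimage (hα : α.IsNondegenerate) (h : G → k) :
    galoisCan k G (galoisObject α) (canPreimage α h) = 1 ⊗ₜ h := by
  have h1 : ∀ g, galoisCan k G (galoisObject α) (canPreimageSingle α g) =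
      1 ⊗ₜ (Pi.single g 1 : G → k) := by
    intro g
    rw [galoisCan_apply, Finset.sum_eq_single g]
    · rw [mulSMul_canPreimageSingle hα, if_pos rfl]
    · intro g' _ hg
      rw [mulSMul_canPreimageSingle hα, if_neg hg.symm, TensorProduct.zero_tmul]
    · simp
  rw [canPreimage_apply, map_sum]
  simp only [map_smul, h1, ← TensorProduct.tmul_smul, ← TensorProduct.tmul_sum]
  congr 1
  ext g
  simp [Finset.sum_apply, Pi.single_apply]

variable {α} in
-- The identity `y₀ y₁^[1] ⊗ y₁^[2] = 1 ⊗ y`, which makes the candidate inverse of `can` a left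
-- inverse. The factor `g.y` takes the value `y(rg)` at `r`; the Casimir element carries this value
-- to the second leg, where it is right multiplication by `y` at `rg`. It remains to see that the
-- preimages sum to `1 ⊗ 1`.
lemma sum_mulLeft_canPreimageSingle (hα : α.IsNondegenerate) (y : galoisObject α) :
    ∑ g : G, (LinearMap.mulLeft k (g • y)).rTensor (galoisObject α) (canPreimageSingle α g) =
      1 ⊗ₜ[k] y := by
  have hc : ((Fintype.card S : k) ^ 2) ≠ 0 :=
    pow_ne_zero _ (Nat.cast_ne_zero.2 Fintype.card_ne_zero)
  have h1 : ∀ g r : G, (LinearMap.mulLeft k (g • y)).rTensor (galoisObject α)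
      (TensorProduct.map (extend α r) (extend α (r * g)) (casimir α)) =
      (LinearMap.mulRight k y).lTensor (galoisObject α)
      (TensorProduct.map (extend α r) (extend α (r * g)) (casimir α)) := by
    intro g r
    have e1 : LinearMap.mulLeft k (g • y) ∘ₗ extend α r =
        extend α r ∘ₗ LinearMap.mulLeft k (y.1 (r * g)) := by
      refine LinearMap.ext fun b => ?_
      exact mul_extend α (g • y) r b
    have e2 : LinearMap.mulRight k y ∘ₗ extend α (r * g) =
        extend α (r * g) ∘ₗ LinearMap.mulRight k (y.1 (r * g)) := by
      refine LinearMap.ext fun b => ?_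
      exact extend_mul α y (r * g) b
    rw [← LinearMap.comp_apply, LinearMap.rTensor_comp_map, e1, ← LinearMap.map_comp_rTensor,
      LinearMap.comp_apply, map_mulLeft_casimir, ← LinearMap.comp_apply,
      LinearMap.map_comp_lTensor, ← e2, ← LinearMap.lTensor_comp_map, LinearMap.comp_apply]
  have h2 : ∀ b, ∑ r, extend α r b = ((Fintype.card S : k) * (basis α).repr b 1) •
      ((α.toFun 1 1 : k) • (1 : galoisObject α)) := by
    intro b
    ext u
    rw [sum_apply, sum_extend_apply, sumConj_eq hα, x_one]
    rfl
  have h3 : ∑ g : G, ∑ r : G,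
      TensorProduct.map (extend α r) (extend α (r * g)) (casimir α) =
      ((Fintype.card S : k) ^ 2) • (1 : galoisObject α) ⊗ₜ[k] (1 : galoisObject α) := by
    -- The pair `(r, rg)` runs over all of `G × G`, so the two legs decouple; by `h2` only `q = 1`
    -- survives in the Casimir sum.
    have e1 : ∀ b c : α.TwistedGroupAlgebra, ∑ g : G, ∑ r : G,
        extend α r b ⊗ₜ[k] extend α (r * g) c =
        (∑ r, extend α r b) ⊗ₜ[k] (∑ r, extend α r c) := by
      intro b c
      rw [Finset.sum_comm, TensorProduct.sum_tmul]
      refine Finset.sum_congr rfl fun r _ => ?_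
      rw [← TensorProduct.tmul_sum]
      congr 1
      exact Equiv.sum_comp (Equiv.mulLeft r) fun q => extend α q c
    classical
    simp only [casimir, map_sum, TensorProduct.map_tmul]
    rw [Finset.sum_congr rfl fun g _ => Finset.sum_comm, Finset.sum_comm, Finset.sum_eq_single 1]
    · have hx : ((xUnit α (1 : S))⁻¹ : (α.TwistedGroupAlgebra)ˣ).val =
          ((α.toFun 1 1)⁻¹ : kˣ).val • (1 : α.TwistedGroupAlgebra) := by
        rw [Units.inv_eq_of_mul_eq_one_right]
        rw [val_xUnit, x_one, smul_mul_smul_comm, ← Units.val_mul, mul_inv_cancel]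
        simp
      have hM : ∑ r, extend α r 1 = (Fintype.card S : k) • (1 : galoisObject α) := by
        ext u
        rw [sum_apply, sum_extend_apply, sumConj_one]
        rfl
      have hu : (α.toFun 1 1 : k) * (((α.toFun 1 1)⁻¹ : kˣ) : k) = 1 := Units.mul_inv _
      rw [e1, hx, x_one]
      simp only [map_smul, ← Finset.smul_sum, hM]
      rw [smul_smul, smul_smul, TensorProduct.smul_tmul_smul]
      congr 1
      linear_combination (Fintype.card S : k) ^ 2 * hu
    · intro q _ hq
      rw [e1, h2, repr_x, if_neg hq]
      simp
    · simp
  simp only [canPreimageSingle, map_smul, map_sum, h1]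
  simp only [← map_sum, ← Finset.smul_sum]
  rw [h3, map_smul, inv_smul_smul₀ hc, LinearMap.lTensor_tmul, LinearMap.mulRight_apply, one_mul]

variable {α} in
lemma galoisCan_bijective (hα : α.IsNondegenerate) :
    Function.Bijective (galoisCan k G (galoisObject α)) := by
  constructor
  -- The candidate inverse `a ⊗ h ↦ a h^[1] ⊗ h^[2]`.
  · let L : galoisObject α ⊗[k] (G → k) →ₗ[k] galoisObject α ⊗[k] galoisObject α :=
      TensorProduct.lift ((LinearMap.rTensorHom (galoisObject α) ∘ₗ
        LinearMap.mul k (galoisObject α)).compl₂ (canPreimage α))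
    have hL : ∀ (a : galoisObject α) (h : G → k), L (a ⊗ₜ h) =
      (LinearMap.mulLeft k a).rTensor (galoisObject α) (canPreimage α h) := fun _ _ => rfl
    have : L ∘ₗ galoisCan k G (galoisObject α) = LinearMap.id := by
      refine TensorProduct.ext' fun a y => ?_
      rw [LinearMap.comp_apply, galoisCan_apply, map_sum]
      simp only [mulSMul_tmul, hL, canPreimage_single, LinearMap.mulLeft_mul,
        LinearMap.rTensor_comp, LinearMap.comp_apply]
      rw [← map_sum, sum_mulLeft_canPreimageSingle hα]
      simp
    exact Function.LeftInverse.injective (g := L) (LinearMap.congr_fun this)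
  · rw [← LinearMap.range_eq_top, eq_top_iff, ← TensorProduct.span_tmul_eq_top, Submodule.span_le]
    rintro _ ⟨a, h, rfl⟩
    refine ⟨(LinearMap.mulLeft k a).rTensor (galoisObject α) (canPreimage α h), ?_⟩
    rw [galoisCan_mulLeft, galoisCan_canPreimage hα]
    simp

variable {α} in
lemma eq_smul_x_one_of_conj_eq (hα : α.IsNondegenerate) {b : α.TwistedGroupAlgebra}
    (hb : ∀ s, conj α s b = b) : b = (basis α).repr b 1 • x α 1 := by
  have hc : (Fintype.card S : k) ≠ 0 := Nat.cast_ne_zero.2 Fintype.card_ne_zero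
  have h := sumConj_eq hα b
  rw [sumConj_apply, Finset.sum_congr rfl fun s _ => hb s, Finset.sum_const, Finset.card_univ,
    ← Nat.cast_smul_eq_nsmul k, mul_smul] at h
  exact smul_right_injective _ hc h

variable {α} in
/-- The algebra `A(G, S, α)` of a non-degenerate cocycle is a Galois object. -/
lemma isGaloisObject (hα : α.IsNondegenerate) : IsGaloisObject k G (galoisObject α) where
  nontrivial := by
    refine ⟨1, 0, fun h => ?_⟩
    have := congrArg (eval α 1) h
    rw [map_zero, eval_apply, one_apply] at this
    exact one_ne_zero this
  coinvariants a := by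
    rw [galoisCoaction_eq_tmul_one_iff, Algebra.mem_bot]
    constructor
    · intro h
      -- A `G`-invariant function is constant, so by equivariance its value is fixed by all
      -- conjugations and is a scalar.
      have h1 : ∀ g, a.1 g = a.1 1 := fun g => by
        rw [← one_mul g, ← galoisObject_smul_apply, h g]
      have h2 := eq_smul_x_one_of_conj_eq hα (b := a.1 1) fun s => by
        rw [← a.2 s 1, h1]
      rw [x_one, smul_smul] at h2
      refine ⟨(basis α).repr (a.1 1) 1 * (α.toFun 1 1 : k), ?_⟩
      ext g
      rw [h1 g, Algebra.algebraMap_eq_smul_one]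
      exact h2.symm
    · rintro ⟨c, rfl⟩ g
      rfl
  can_bijective := galoisCan_bijective hα

variable {α} in
/-- The Miyashita-Ulbrich action on `A(G, S, α)`. -/
lemma miyashitaUlbrich_apply (hα : α.IsNondegenerate) (a : galoisObject α) (h : G → k) (u : G) :
    (miyashitaUlbrich k G a h).1 u =
      ∑ s : S, h (u⁻¹ * s * u) • ((basis α).repr (a.1 u) s • x α s) := by
  classical
  have hc : ((Fintype.card S : k) ^ 2) ≠ 0 :=
    pow_ne_zero _ (Nat.cast_ne_zero.2 Fintype.card_ne_zero)
  -- The case `y = a(u)`, `u' = u`: the idempotent `e_g` picks out the component indexed by `ugu⁻¹`,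
  -- if this lies in `S`.
  have h1 : ∀ g, (sandwich k a (canPreimageSingle α g)).1 u =
      if h : u * g * u⁻¹ ∈ S then
      (basis α).repr (a.1 u) ⟨u * g * u⁻¹, h⟩ • x α ⟨u * g * u⁻¹, h⟩ else 0 := by
    intro g
    simp only [canPreimageSingle_eq, map_smul, map_sum, sandwich_tmul]
    change ((Fintype.card S : k) ^ 2)⁻¹ • eval α u _ = _
    simp only [map_sum, eval_apply, mul_apply]
    rw [sum_sum_extend_mul_mul hα g u u (a.1 u), inv_smul_smul₀ hc]
  rw [miyashitaUlbrich_eq (galoisCan_bijective hα).1 a (galoisCan_canPreimage hα h),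
    canPreimage_apply, map_sum, sum_apply]
  refine (Fintype.sum_of_injective (fun s : S => u⁻¹ * (s : G) * u) ?_ _ _ ?_ ?_).symm
  · intro s t hst
    simpa using hst
  · intro g hg
    rw [map_smul]
    change h g • (sandwich k a (canPreimageSingle α g)).1 u = 0
    rw [h1, dif_neg, smul_zero]
    intro hmem
    exact hg ⟨⟨_, hmem⟩, by simp [mul_assoc]⟩
  · intro s
    rw [map_smul]
    change _ = h _ • (sandwich k a (canPreimageSingle α _)).1 u
    have e : u * (u⁻¹ * (s : G) * u) * u⁻¹ = s := by simp [mul_assoc]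
    have hmem : u * (u⁻¹ * (s : G) * u) * u⁻¹ ∈ S := by rw [e]; exact s.2
    have e' : (⟨_, hmem⟩ : S) = s := Subtype.ext e
    rw [h1, dif_pos hmem, e']

end galoisObject

end GaloisObjectStructure

/-! ### Stability of `A^F` under the Miyashita–Ulbrich action and the inclusion `S ≤ F`. -/

section FixedSubspace

open TwoCocycle TwoCocycle.TwistedGroupAlgebra

variable {k G : Type*} [Field k] [Group G] {S : Subgroup G} {α : TwoCocycle S k}

lemma Subgroup.eq_or_eq_top_of_index_prime {F K : Subgroup G} (hF : F.index.Prime) (h : F ≤ K) :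
    K = F ∨ K = ⊤ := by
  rcases (Nat.dvd_prime hF).1 (Subgroup.index_dvd_of_le h) with h1 | h1
  · exact Or.inr (Subgroup.index_eq_one.1 h1)
  · left
    have h2 := Subgroup.relIndex_mul_index h
    rw [h1] at h2
    have h3 : F.relIndex K = 1 := Nat.eq_of_mul_eq_mul_right hF.pos (by rw [h2, one_mul])
    exact le_antisymm (Subgroup.relIndex_eq_one.1 h3) h

namespace TwoCocycle.TwistedGroupAlgebra

/-- A subset `N ∋ 1` for which all the sums `∑ n ∈ N, x_n x_t x_n⁻¹`, `t ≠ 1`, have zero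
`x_t`-component is the whole group. -/
lemma eq_univ_of_sum_repr_conj_eq_zero {S : Type*} [Group S] [Fintype S] [CharZero k]
    {α : TwoCocycle S k} (hα : α.IsNondegenerate) (N : Finset S) (h1 : 1 ∈ N)
    (h : ∀ t, t ≠ 1 → ∑ n ∈ N, (basis α).repr (conj α n (x α t)) t = 0) :
    N = Finset.univ := by
  have hc : (Fintype.card S : k) ≠ 0 := Nat.cast_ne_zero.2 Fintype.card_ne_zero
  let inv : S → α.TwistedGroupAlgebra := fun s => ((xUnit α s)⁻¹ : (α.TwistedGroupAlgebra)ˣ)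
  have hinv : ∀ s, inv s = ((α.toFun s s⁻¹ * α.toFun 1 1)⁻¹ : kˣ).val • x α s⁻¹ := fun _ => rfl
  have hmul : ∀ s, x α s * inv s = 1 := fun s => (xUnit α s).mul_inv
  -- The elements `x_n x_t x_n⁻¹ x_t⁻¹` are counted twice. Grouping them as `x_n (x_t x_n⁻¹ x_t⁻¹)`,
  -- the sum over `t` is an average, which vanishes unless `n = 1`.
  have h2 : ∀ n, ∑ t, conj α n (x α t) * inv t = x α n * sumConj α (inv n) := by
    intro n
    rw [sumConj_apply, Finset.mul_sum]
    refine Finset.sum_congr rfl fun t _ => ?_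
    simp only [conj, mul_assoc, val_xUnit, inv]
  have h3 : ∑ n ∈ N, ∑ t, conj α n (x α t) * inv t = (Fintype.card S : k) • 1 := by
    simp only [h2]
    rw [Finset.sum_eq_single_of_mem 1 h1]
    · rw [hinv, map_smul, inv_one, x_one, map_smul, sumConj_one]
      have : x α 1 * inv 1 = 1 := hmul 1
      rw [hinv, inv_one, x_one, smul_smul] at this
      rw [smul_comm (α.toFun 1 1 : k), smul_comm _ (Fintype.card S : k), mul_smul_comm, smul_smul,
        this]
    · intro n _ hn
      rw [hinv, map_smul, sumConj_x hα (inv_ne_one.2 hn), smul_zero, mul_zero]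
  -- In the other order, a further average kills every `t ≠ 1`, since by `sumConj_mul_inv` it sees
  -- only the `x_t`-component assumed to vanish. Only `t = 1` remains, giving `|N||S|` against
  -- `|S|²`.
  have h4 : ∀ t, t ≠ 1 → sumConj α (∑ n ∈ N, conj α n (x α t) * inv t) = 0 := by
    intro t ht
    have e : sumConj α ((∑ n ∈ N, conj α n (x α t)) * inv t) * x α t = 0 := by
      rw [sumConj_mul_inv hα, map_sum, Finsupp.finsetSum_apply, h t ht, mul_zero, zero_smul]
    rw [← Finset.sum_mul]
    exact (xUnit α t).mul_left_eq_zero.1 e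
  have h5 : sumConj α (∑ n ∈ N, ∑ t, conj α n (x α t) * inv t) =
      ((Finset.card N : k) * (Fintype.card S : k)) • (1 : α.TwistedGroupAlgebra) := by
    rw [Finset.sum_comm, map_sum, Finset.sum_eq_single 1]
    · have : ∀ n ∈ N, conj α n (x α 1) * inv 1 = 1 := by
        intro n _
        rw [← hmul 1, x_one, conj_smul, conj_one_right]
      rw [Finset.sum_congr rfl this, Finset.sum_const, map_nsmul, sumConj_one,
        ← Nat.cast_smul_eq_nsmul k, smul_smul]
    · exact fun t _ ht => h4 t ht
    · simp
  rw [h3, map_smul, sumConj_one, smul_smul] at h5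
  have h6 := smul_left_injective k (one_ne_zero (α := α.TwistedGroupAlgebra)) h5
  have h7 := mul_right_cancel₀ hc h6
  rw [← Finset.card_eq_iff_eq_univ]
  exact_mod_cast h7.symm

end TwoCocycle.TwistedGroupAlgebra

namespace galoisObject

variable [Fintype G] [DecidableEq G] [CharZero k]

lemma isMiyashitaUlbrichStable_of_le (hα : α.IsNondegenerate) {F : Subgroup G} [F.Normal]
    (h : S ≤ F) :
    IsMiyashitaUlbrichStable G (fixedSubspace k (galoisObject α) F) := by
  classical
  have := Fintype.ofFinite S
  intro a ha f
  have h1 : ∀ u (s : S), conj α s (a.1 u) = a.1 u := by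
    intro u s
    have hmem : u⁻¹ * s * u ∈ F := by
      simpa using (inferInstance : F.Normal).conj_mem s (h s.2) u⁻¹
    -- As `F` is normal, `su = u(u⁻¹su)` with `u⁻¹su ∈ F`, so `a(su) = a(u)`: left translation by
    -- `S` is absorbed by `F`-invariance.
    have h2 := congrArg (fun b : galoisObject α => b.1 u) (ha _ hmem)
    simp only [galoisObject_smul_apply] at h2
    rw [← a.2 s u, ← h2]
    simp [mul_assoc]
  have h2 : miyashitaUlbrich k G a f = f 1 • a := by
    ext u
    rw [miyashitaUlbrich_apply hα, Finset.sum_eq_single 1]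
    · rw [← eq_smul_x_one_of_conj_eq hα (h1 u), Subgroup.coe_one, mul_one, inv_mul_cancel]
      rfl
    · intro s _ hs
      rw [eq_smul_x_one_of_conj_eq hα (h1 u), map_smul, Finsupp.smul_apply, repr_x,
        if_neg (Ne.symm hs)]
      simp
    · simp
  rw [h2]
  exact Submodule.smul_mem _ _ ha

lemma le_of_isMiyashitaUlbrichStable (hα : α.IsNondegenerate) (hZ : Subgroup.center G = ⊥)
    {F : Subgroup G} (hF : F.index.Prime)
    (h : IsMiyashitaUlbrichStable G (fixedSubspace k (galoisObject α) F)) : S ≤ F := by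
  classical
  have := Fintype.ofFinite S
  let N : Finset S := Finset.univ.filter fun s => (s : G) ∈ F
  suffices hN : N = Finset.univ by
    intro s hs
    have : (⟨s, hs⟩ : S) ∈ N := hN ▸ Finset.mem_univ _
    exact (Finset.mem_filter.1 this).2
  refine eq_univ_of_sum_repr_conj_eq_zero hα N (by simp [N]) fun t ht => ?_
  by_contra hne
  -- the average over `F` of the function supported on `S` with value `x_t` at `1`
  let a : galoisObject α := ∑ m : F, (m : G) • extend α 1 (x α t)
  have ha : a ∈ fixedSubspace k (galoisObject α) F := by
    intro g hg
    simp only [a, Finset.smul_sum, ← mul_smul]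
    exact Equiv.sum_comp (Equiv.mulLeft (⟨g, hg⟩ : F)) fun m => (m : G) • extend α 1 (x α t)
  have ha' : ∀ m ∈ F, a.1 m = a.1 1 := by
    intro m hm
    rw [← one_mul m, ← galoisObject_smul_apply, ha m hm]
  have ha1 : a.1 1 = ∑ n ∈ N, conj α n (x α t) := by
    simp only [a, sum_apply, galoisObject_smul_apply, one_mul]
    have : ∑ m : F, (extend α 1 (x α t)).1 (m : G) =
        ∑ m : G, if m ∈ F then (extend α 1 (x α t)).1 m⁻¹⁻¹ else 0 := by
      rw [← Finset.sum_filter]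
      refine Finset.sum_bij (fun m _ => (m : G)) (by simp) (fun _ _ _ _ h => Subtype.ext h)
        (fun g hg => ⟨⟨g, (Finset.mem_filter.1 hg).2⟩, Finset.mem_univ _, rfl⟩) (by simp)
    -- `sum_eq_sum_subgroup` samples at `s⁻¹`; inverting the summation variable first makes the sum
    -- run over `s ∈ S`, restricted by the `if` to `S ∩ F`.
    rw [this, ← Equiv.sum_comp (Equiv.inv G), sum_eq_sum_subgroup (S := S) 1]
    · rw [Finset.sum_filter]
      refine Finset.sum_congr rfl fun s _ => ?_
      simp only [mul_one, Equiv.inv_apply, inv_inv]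
      congr 1
      exact extend_apply_of_eq α s (mul_one _).symm _
    · intro r hr
      simp only [Equiv.inv_apply, inv_inv]
      rw [extend_apply_of_notMem α (by simpa using hr), ite_self]
  have hne' : (basis α).repr (a.1 1) t ≠ 0 := by
    rwa [ha1, map_sum, Finsupp.finsetSum_apply]
  -- `t` commutes with `F`
  have hcomm : ∀ m ∈ F, m⁻¹ * (t : G) * m = t := by
    intro m hm
    -- Acting by `e_t` keeps the `x_t`-component at the point `1`, but at `m` only if `m⁻¹tm = t`.
    -- Since `a(m) = a(1)` has nonzero `x_t`-component and the result is again `F`-invariant, `m`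
    -- must commute with `t`.
    have h1 := h a ha (Pi.single (t : G) 1) m hm
    have h2 := congrArg (fun b : galoisObject α => (basis α).repr (b.1 1) t) h1
    simp only [galoisObject_smul_apply, one_mul, miyashitaUlbrich_apply hα, ha' m hm, map_sum,
      Finsupp.finsetSum_apply, map_smul, Finsupp.smul_apply, repr_x] at h2
    rw [Finset.sum_eq_single t, Finset.sum_eq_single t] at h2
    · by_contra hmt
      apply hne'
      simpa [Pi.single_apply, hmt] using h2.symm
    · intro s _ hs
      simp [hs]
    · simp
    · intro s _ hs
      simp [hs]
    · simp
  have hle : F ≤ Subgroup.centralizer {(t : G)} := by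
    intro m hm
    rw [Subgroup.mem_centralizer_singleton_iff]
    have := hcomm m hm
    rw [mul_assoc, inv_mul_eq_iff_eq_mul] at this
    exact this.symm
  have hcent : Subgroup.centralizer {(t : G)} = F := by
    refine (Subgroup.eq_or_eq_top_of_index_prime hF hle).resolve_right fun htop => ht ?_
    have : (t : G) ∈ Subgroup.center G := by
      rw [Subgroup.mem_center_iff]
      intro g
      have : g ∈ Subgroup.centralizer {(t : G)} := htop ▸ Subgroup.mem_top g
      exact Subgroup.mem_centralizer_singleton_iff.1 this
    rw [hZ, Subgroup.mem_bot] at this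
    exact Subtype.ext this
  apply hne
  -- Now `S ∩ F = C_S(t)`. For other `s`, `x_s x_t x_s⁻¹` is a multiple of a basis vector different
  -- from `x_t`, so the partial sum agrees with the full one, which is zero.
  rw [← repr_sumConj_x_self hα ht, Finset.sum_filter]
  refine Finset.sum_congr rfl fun s _ => ?_
  split_ifs with hs
  · rfl
  · obtain ⟨c, hc⟩ := exists_conj_x α s t
    rw [hc, map_smul, Finsupp.smul_apply, repr_x, if_neg, smul_zero]
    intro heq
    apply hs
    rw [← hcent, Subgroup.mem_centralizer_singleton_iff]
    have := congrArg Subtype.val (mul_inv_eq_iff_eq_mul.1 heq)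
    exact this

end galoisObject

end FixedSubspace

/-! ### Adjoint actions of the dual Hopf algebra and the coadjoint coaction. -/

section AdjointActions

open Module

variable (k K : Type*) [Field k] [Ring K] [HopfAlgebra k K]

/-- The map `(p ⊗ q) ⊗ r ↦ q ⊗ (p ⊗ r)`. -/
def moveSecondToFront : (K ⊗[k] K) ⊗[k] K →ₗ[k] K ⊗[k] (K ⊗[k] K) :=
  (TensorProduct.assoc k K K K).toLinearMap ∘ₗ
    (TensorProduct.comm k K K).toLinearMap.rTensor K

@[simp] lemma moveSecondToFront_tmul (p q r : K) :
    moveSecondToFront k K ((p ⊗ₜ q) ⊗ₜ r) = q ⊗ₜ (p ⊗ₜ r) := rfl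

/-- The iterated comultiplication `y ↦ (y₁ ⊗ y₂) ⊗ y₃`. -/
def comulTwice : K →ₗ[k] (K ⊗[k] K) ⊗[k] K :=
  (Coalgebra.comul (R := k) (A := K)).rTensor K ∘ₗ Coalgebra.comul

/-- The map `p ⊗ r ↦ S(p) r`. -/
def antipodeMul : K ⊗[k] K →ₗ[k] K :=
  LinearMap.mul' k K ∘ₗ (HopfAlgebra.antipode k (A := K)).rTensor K

@[simp] lemma antipodeMul_tmul (p r : K) :
    antipodeMul k K (p ⊗ₜ r) = HopfAlgebra.antipode k p * r := rfl

/-- The coadjoint coaction `y ↦ y₂ ⊗ S(y₁) y₃`. -/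
def coadjoint : K →ₗ[k] K ⊗[k] K :=
  (antipodeMul k K).lTensor K ∘ₗ moveSecondToFront k K ∘ₗ comulTwice k K

variable {k K}

lemma dualMul_apply (f g : Dual k K) (y : K) :
    dualMul k K f g y = TensorProduct.dualDistrib k K K (f ⊗ₜ g) (Coalgebra.comul y) := rfl

lemma dualMul_dualMul_apply (f g h : Dual k K) (y : K) :
    dualMul k K (dualMul k K f g) h y =
      TensorProduct.dualDistrib k _ _ (TensorProduct.dualDistrib k _ _ (f ⊗ₜ g) ⊗ₜ h)
        (comulTwice k K y) := by
  rw [dualMul_apply, comulTwice, LinearMap.comp_apply]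
  generalize (Coalgebra.comul (R := k) y) = z
  induction z with
  | zero => simp
  | add a b ha hb => simp only [map_add, ha, hb]
  | tmul a b => rfl

lemma dualMul_assoc (f g h : Dual k K) :
    dualMul k K (dualMul k K f g) h = dualMul k K f (dualMul k K g h) := by
  ext y
  have h1 : dualMul k K f (dualMul k K g h) y =
      TensorProduct.dualDistrib k _ _ (f ⊗ₜ TensorProduct.dualDistrib k _ _ (g ⊗ₜ h))
        ((Coalgebra.comul (R := k) (A := K)).lTensor K (Coalgebra.comul (R := k) y)) := by
    rw [dualMul_apply]
    generalize (Coalgebra.comul (R := k) y) = z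
    induction z with
    | zero => simp
    | add a b ha hb => simp only [map_add, ha, hb]
    | tmul a b => rfl
  rw [dualMul_dualMul_apply, h1, ← Coalgebra.coassoc_apply, comulTwice, LinearMap.comp_apply]
  generalize ((Coalgebra.comul (R := k) (A := K)).rTensor K (Coalgebra.comul (R := k) y)) = z
  have : TensorProduct.dualDistrib k _ _ (TensorProduct.dualDistrib k _ _ (f ⊗ₜ g) ⊗ₜ h) =
      TensorProduct.dualDistrib k _ _ (f ⊗ₜ TensorProduct.dualDistrib k _ _ (g ⊗ₜ h)) ∘ₗ
        (TensorProduct.assoc k K K K).toLinearMap := by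
    refine TensorProduct.ext_threefold fun a b c => ?_
    simp [mul_assoc]
  exact LinearMap.congr_fun this z

lemma dualMul_counit (f : Dual k K) : dualMul k K f Coalgebra.counit = f := by
  ext y
  have h := congrArg (fun z => TensorProduct.rid k k (f.rTensor k z))
    (Coalgebra.lTensor_counit_comul (R := k) y)
  simp only [LinearMap.rTensor_tmul, TensorProduct.rid_tmul, one_smul] at h
  rw [← h, dualMul_apply]
  generalize (Coalgebra.comul (R := k) y) = z
  induction z with
  | zero => simp
  | add a b ha hb => simp only [map_add, ha, hb]
  | tmul a b => simp [mul_comm]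

variable [FiniteDimensional k K]

lemma dualDistrib_dualComul (f : Dual k K) (z : K ⊗[k] K) :
    TensorProduct.dualDistrib k K K (dualComul k K f) z = f (LinearMap.mul' k K z) := by
  have : TensorProduct.dualDistribEquiv k K K (dualComul k K f) =
      (LinearMap.mul' k K).dualMap f :=
    (TensorProduct.dualDistribEquiv k K K).apply_symm_apply _
  exact LinearMap.congr_fun this z

/-- Evaluating `S(f₁) g f₂` at `y` gives `f₁(S(y₁)) g(y₂) f₂(y₃)`, and `f₁ ⊗ f₂` recombines into
`f(S(y₁) y₃)`. -/
lemma dualAdjointRight_apply (f g : Dual k K) (y : K) :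
    dualAdjointRight f g y = TensorProduct.dualDistrib k K K (g ⊗ₜ f) (coadjoint k K y) := by
  let σ : K ⊗[k] K →ₗ[k] K ⊗[k] K := (HopfAlgebra.antipode k (A := K)).rTensor K
  have h1 : ∀ t : Dual k K ⊗[k] Dual k K, TensorProduct.lift
      (dualMul k K ∘ₗ (dualMul k K).flip g ∘ₗ dualAntipode k K) t y =
      TensorProduct.dualDistrib k _ _ (g ⊗ₜ (TensorProduct.dualDistrib k _ _ t ∘ₗ σ))
        (moveSecondToFront k K (comulTwice k K y)) := by
    intro t
    induction t with
    | zero => simp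
    | add a b ha hb =>
      simp only [map_add, LinearMap.add_apply, ha, hb, LinearMap.add_comp, TensorProduct.tmul_add]
    | tmul a b =>
      change dualMul k K (dualMul k K (dualAntipode k K a) g) b y = _
      rw [dualMul_dualMul_apply]
      generalize comulTwice k K y = z
      have : TensorProduct.dualDistrib k _ _
          (TensorProduct.dualDistrib k _ _ (dualAntipode k K a ⊗ₜ g) ⊗ₜ b) =
          TensorProduct.dualDistrib k _ _
            (g ⊗ₜ (TensorProduct.dualDistrib k _ _ (a ⊗ₜ b) ∘ₗ σ)) ∘ₗ
            moveSecondToFront k K := by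
        refine TensorProduct.ext_threefold fun p q r => ?_
        simp [σ, dualAntipode]
        ring
      exact LinearMap.congr_fun this z
  rw [dualAdjointRight, h1, coadjoint, LinearMap.comp_apply, LinearMap.comp_apply]
  generalize moveSecondToFront k K (comulTwice k K y) = z
  induction z with
  | zero => simp
  | add a b ha hb => simp only [map_add, ha, hb]
  | tmul a b =>
    rw [TensorProduct.dualDistrib_apply, LinearMap.lTensor_tmul, TensorProduct.dualDistrib_apply,
      LinearMap.comp_apply, dualDistrib_dualComul]
    rfl

/-- Contracting the coadjoint coaction with a functional whose left slices lie in a normal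
subspace gives an element of this subspace. -/
lemma IsNormalInDual.comp_coadjoint_mem {W : Submodule k (Dual k K)} (hW : IsNormalInDual W)
    (Φ : K ⊗[k] K →ₗ[k] k) (hΦ : ∀ w, Φ ∘ₗ (TensorProduct.mk k K K).flip w ∈ W) :
    Φ ∘ₗ coadjoint k K ∈ W := by
  let b := Module.finBasis k K
  -- Expanding the second leg in a basis writes `Φ` as a sum of pure tensors `Φ(- ⊗ b i) ⊗ b i*`;
  -- each becomes a right adjoint action on a slice lying in `W`.
  have h : Φ = ∑ i, TensorProduct.dualDistrib k K K
      ((Φ ∘ₗ (TensorProduct.mk k K K).flip (b i)) ⊗ₜ b.coord i) := by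
    refine TensorProduct.ext' fun p q => ?_
    rw [LinearMap.sum_apply]
    simp only [TensorProduct.dualDistrib_apply, LinearMap.comp_apply, LinearMap.flip_apply,
      TensorProduct.mk_apply, Basis.coord_apply]
    calc Φ (p ⊗ₜ q) = Φ (p ⊗ₜ ∑ i, b.repr q i • b i) := by rw [b.sum_repr]
      _ = _ := by
        rw [TensorProduct.tmul_sum, map_sum]
        refine Finset.sum_congr rfl fun i _ => ?_
        rw [TensorProduct.tmul_smul, map_smul, smul_eq_mul, mul_comm]
  have h2 : Φ ∘ₗ coadjoint k K =
      ∑ i, dualAdjointRight (b.coord i) (Φ ∘ₗ (TensorProduct.mk k K K).flip (b i)) := by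
    ext y
    rw [LinearMap.sum_apply]
    simp only [dualAdjointRight_apply]
    conv_lhs => rw [h]
    simp
  rw [h2]
  exact Submodule.sum_mem _ fun i _ => (hW _ _ (hΦ _)).2

/-- A subspace of central elements of the dual Hopf algebra is stable under the adjoint
actions. -/
lemma isNormalInDual_of_central {W : Submodule k (Dual k K)}
    (hW : ∀ f, ∀ g ∈ W, dualMul k K f g = dualMul k K g f) : IsNormalInDual W := by
  intro f g hg
  let L : Dual k K ⊗[k] Dual k K →ₗ[k] Dual k K :=
    TensorProduct.lift ((dualMul k K).compl₂ (dualAntipode k K))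
  let R : Dual k K ⊗[k] Dual k K →ₗ[k] Dual k K :=
    TensorProduct.lift (dualMul k K ∘ₗ dualAntipode k K)
  have hL : ∀ t, TensorProduct.lift
      (((dualMul k K).compl₂ (dualAntipode k K)) ∘ₗ (dualMul k K).flip g) t =
      dualMul k K g (L t) := by
    intro t
    induction t with
    | zero => simp
    | add a b ha hb => simp only [map_add, ha, hb]
    | tmul a b =>
      change dualMul k K (dualMul k K a g) (dualAntipode k K b) =
        dualMul k K g (dualMul k K a (dualAntipode k K b))
      rw [hW a g hg, dualMul_assoc]
  have hR : ∀ t, TensorProduct.lift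
      (dualMul k K ∘ₗ (dualMul k K).flip g ∘ₗ dualAntipode k K) t =
      dualMul k K g (R t) := by
    intro t
    induction t with
    | zero => simp
    | add a b ha hb => simp only [map_add, ha, hb]
    | tmul a b =>
      change dualMul k K (dualMul k K (dualAntipode k K a) g) b =
        dualMul k K g (dualMul k K (dualAntipode k K a) b)
      rw [hW _ g hg, dualMul_assoc]
  -- The antipode axiom `f₁ S(f₂) = ε(f) 1` in `K*`, whose counit is evaluation at `1` and whose
  -- unit is the counit of `K`.
  have hL1 : L (dualComul k K f) = f 1 • Coalgebra.counit := by
    have h1 : ∀ t (y : K), L t y = TensorProduct.dualDistrib k K K t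
        ((HopfAlgebra.antipode k (A := K)).lTensor K (Coalgebra.comul y)) := by
      intro t y
      induction t with
      | zero => simp
      | add a b ha hb => simp only [map_add, LinearMap.add_apply, ha, hb]
      | tmul a b =>
        change dualMul k K a (dualAntipode k K b) y = _
        rw [dualMul_apply]
        generalize (Coalgebra.comul (R := k) y) = z
        induction z with
        | zero => simp
        | add a b ha hb => simp only [map_add, ha, hb]
        | tmul a b => rfl
    ext y
    rw [h1, dualDistrib_dualComul, HopfAlgebra.mul_antipode_lTensor_comul_apply,
      Algebra.algebraMap_eq_smul_one, map_smul, LinearMap.smul_apply, smul_eq_mul, smul_eq_mul,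
      mul_comm]
  have hR1 : R (dualComul k K f) = f 1 • Coalgebra.counit := by
    have h1 : ∀ t (y : K), R t y = TensorProduct.dualDistrib k K K t
        ((HopfAlgebra.antipode k (A := K)).rTensor K (Coalgebra.comul y)) := by
      intro t y
      induction t with
      | zero => simp
      | add a b ha hb => simp only [map_add, LinearMap.add_apply, ha, hb]
      | tmul a b =>
        change dualMul k K (dualAntipode k K a) b y = _
        rw [dualMul_apply]
        generalize (Coalgebra.comul (R := k) y) = z
        induction z with
        | zero => simp
        | add a b ha hb => simp only [map_add, ha, hb]
        | tmul a b => rfl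
    ext y
    rw [h1, dualDistrib_dualComul, HopfAlgebra.mul_antipode_rTensor_comul_apply,
      Algebra.algebraMap_eq_smul_one, map_smul, LinearMap.smul_apply, smul_eq_mul, smul_eq_mul,
      mul_comm]
  rw [dualAdjointLeft, hL, hL1, dualAdjointRight, hR, hR1, map_smul, dualMul_counit]
  exact ⟨W.smul_mem _ hg, W.smul_mem _ hg⟩

end AdjointActions

/-! ### Module algebra actions on a Galois object and the Miyashita–Ulbrich action. -/

section ModuleAlgebra

variable {k G A K : Type*} [Field k] [Group G] [Ring A] [Algebra k A]
  [MulSemiringAction G A] [SMulCommClass G k A] [Ring K] [HopfAlgebra k K]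

/-- A right module algebra structure over the Hopf algebra `K` on `A`, `ρ y a = a.y`, commuting
with the action of `G`. -/
structure IsEquivariantModuleAlgebra (G : Type*) [Group G] [MulSemiringAction G A]
    (ρ : K →ₗ[k] A →ₗ[k] A) : Prop where
  mul_apply : ∀ p q a, ρ (p * q) a = ρ q (ρ p a)
  one_apply : ∀ a, ρ 1 a = a
  apply_one : ∀ y, ρ y 1 = Coalgebra.counit (R := k) y • (1 : A)
  apply_mul : ∀ y a b, ρ y (a * b) = LinearMap.mul' k A
    (TensorProduct.homTensorHomMap (.id k) A A A A (TensorProduct.map ρ ρ (Coalgebra.comul y))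
      (a ⊗ₜ b))
  apply_smul : ∀ y (g : G) a, ρ y (g • a) = g • ρ y a

/-- The action of `K ⊗ K` on `A ⊗ A`. -/
def tensorAction (ρ : K →ₗ[k] A →ₗ[k] A) :
    K ⊗[k] K →ₗ[k] (A ⊗[k] A →ₗ[k] A ⊗[k] A) :=
  TensorProduct.homTensorHomMap (.id k) A A A A ∘ₗ TensorProduct.map ρ ρ

@[simp] lemma tensorAction_tmul (ρ : K →ₗ[k] A →ₗ[k] A) (p q : K) :
    tensorAction ρ (p ⊗ₜ q) = TensorProduct.map (ρ p) (ρ q) := rfl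

/-- The map `x ⊗ (a ⊗ b) ↦ a x b`, as a bilinear map. -/
def sandwichBilinear (k A : Type*) [Field k] [Ring A] [Algebra k A] :
    A →ₗ[k] A ⊗[k] A →ₗ[k] A :=
  LinearMap.mk₂ k (fun x z => sandwich k x z)
    (fun x y z => by
      induction z with
      | zero => simp
      | add a b ha hb => rw [map_add, map_add, map_add, ha, hb]; abel
      | tmul a b => simp [mul_add, add_mul])
    (fun c x z => by
      induction z with
      | zero => simp
      | add a b ha hb => rw [map_add, map_add, ha, hb, smul_add]
      | tmul a b => simp)
    (fun x y z => map_add _ _ _) (fun c x z => map_smul _ _ _)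

lemma sandwichBilinear_apply (x : A) (z : A ⊗[k] A) :
    sandwichBilinear k A x z = sandwich k x z := rfl

namespace IsEquivariantModuleAlgebra

variable {ρ : K →ₗ[k] A →ₗ[k] A}

lemma tensorAction_mul (hρ : IsEquivariantModuleAlgebra G ρ) (v w : K ⊗[k] K) (z : A ⊗[k] A) :
    tensorAction ρ (v * w) z = tensorAction ρ w (tensorAction ρ v z) := by
  induction v with
  | zero => simp
  | add a b ha hb => simp only [add_mul, map_add, LinearMap.add_apply, ha, hb]
  | tmul p q =>
    induction w with
    | zero => simp
    | add a b ha hb => simp only [mul_add, map_add, LinearMap.add_apply, ha, hb]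
    | tmul r s =>
      induction z with
      | zero => simp
      | add a b ha hb => simp only [map_add, ha, hb]
      | tmul a b => simp [hρ.mul_apply]

lemma apply_mul' (hρ : IsEquivariantModuleAlgebra G ρ) (y : K) (a b : A) :
    ρ y (a * b) = LinearMap.mul' k A (tensorAction ρ (Coalgebra.comul y) (a ⊗ₜ b)) :=
  hρ.apply_mul y a b

lemma mulSMul_tensorAction_comul (hρ : IsEquivariantModuleAlgebra G ρ) (g : G) (y : K)
    (z : A ⊗[k] A) :
    mulSMul k A g (tensorAction ρ (Coalgebra.comul y) z) = ρ y (mulSMul k A g z) := by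
  induction z with
  | zero => simp
  | add a b ha hb => simp only [map_add, ha, hb]
  | tmul a b =>
    rw [mulSMul_tmul, hρ.apply_mul']
    generalize (Coalgebra.comul (R := k) y) = w
    induction w with
    | zero => simp
    | add p q hp hq => simp only [map_add, LinearMap.add_apply, hp, hq]
    | tmul p q => simp [hρ.apply_smul]

variable [Fintype G] [DecidableEq G]

/-- The map `can` intertwines the diagonal action of `K` on `A ⊗ A` with its action on the first leg
of `A ⊗ k^G`. There `1 ⊗ h` is invariant, so its preimage is too. -/
lemma tensorAction_comul_of_galoisCan_eq (hρ : IsEquivariantModuleAlgebra G ρ)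
    (hcan : Function.Injective (galoisCan k G A)) {h : G → k} {T : A ⊗[k] A}
    (hT : galoisCan k G A T = 1 ⊗ₜ h) (y : K) :
    tensorAction ρ (Coalgebra.comul y) T = Coalgebra.counit (R := k) y • T := by
  apply hcan
  have h1 : ∀ z, galoisCan k G A (tensorAction ρ (Coalgebra.comul y) z) =
      (ρ y).rTensor (G → k) (galoisCan k G A z) := by
    intro z
    simp only [galoisCan_apply, hρ.mulSMul_tensorAction_comul, map_sum, LinearMap.rTensor_tmul]
  rw [h1, map_smul, hT, LinearMap.rTensor_tmul, hρ.apply_one, TensorProduct.smul_tmul']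

/-- Write `y ⊗ 1 = Δ(y₁)(1 ⊗ S(y₂))` and use invariance of `T` under `Δ(y₁)`. -/
lemma tensorAction_tmul_one (hρ : IsEquivariantModuleAlgebra G ρ)
    (hcan : Function.Injective (galoisCan k G A)) {h : G → k} {T : A ⊗[k] A}
    (hT : galoisCan k G A T = 1 ⊗ₜ h) (y : K) :
    tensorAction ρ (y ⊗ₜ 1) T = tensorAction ρ (1 ⊗ₜ HopfAlgebra.antipode k y) T := by
  let S : K →ₗ[k] K := HopfAlgebra.antipode k
  let κ : K ⊗[k] (K ⊗[k] K) →ₗ[k] K ⊗[k] K := (LinearMap.mul' k K ∘ₗ S.lTensor K).lTensor K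
  let E : K ⊗[k] K →ₗ[k] A ⊗[k] A := (tensorAction ρ).flip T
  have h1 : ∀ (v : K ⊗[k] K) (q : K),
      κ (TensorProduct.assoc k K K K (v ⊗ₜ q)) = v * (1 ⊗ₜ S q) := by
    intro v q
    induction v with
    | zero => simp
    | add a b ha hb => simp only [TensorProduct.add_tmul, map_add, ha, hb, add_mul]
    | tmul a b => simp [κ]
  have h2 : ∀ z : K ⊗[k] K, E (κ (TensorProduct.assoc k K K K
      ((Coalgebra.comul (R := k) (A := K)).rTensor K z))) =
      E ((1 : K) ⊗ₜ S (TensorProduct.lid k K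
        ((Coalgebra.counit (R := k) (A := K)).rTensor K z))) := by
    intro z
    induction z with
    | zero => simp
    | add a b ha hb => simp only [map_add, TensorProduct.tmul_add, ha, hb]
    | tmul p q =>
      rw [LinearMap.rTensor_tmul, h1, LinearMap.flip_apply, hρ.tensorAction_mul,
        hρ.tensorAction_comul_of_galoisCan_eq hcan hT, map_smul]
      simp [E]
  have h3 : κ (TensorProduct.assoc k K K K ((Coalgebra.comul (R := k) (A := K)).rTensor K
      (Coalgebra.comul y))) = y ⊗ₜ 1 := by
    rw [Coalgebra.coassoc_apply]
    have e : κ ∘ₗ (Coalgebra.comul (R := k) (A := K)).lTensor K =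
        (Algebra.linearMap k K ∘ₗ Coalgebra.counit).lTensor K := by
      rw [← LinearMap.lTensor_comp, LinearMap.comp_assoc]
      congr 1
      exact HopfAlgebra.mul_antipode_lTensor_comul
    have e' := LinearMap.congr_fun e (Coalgebra.comul y)
    rw [LinearMap.comp_apply, LinearMap.lTensor_comp, LinearMap.comp_apply,
      Coalgebra.lTensor_counit_comul] at e'
    rw [e']
    simp
  have h4 := h2 (Coalgebra.comul y)
  rw [h3, Coalgebra.rTensor_counit_comul, TensorProduct.lid_tmul, one_smul] at h4
  exact h4

/-- The module algebra axiom applied twice: `(a x b)·y = (a·y₁)(x·y₂)(b·y₃)`. -/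
lemma apply_sandwich (hρ : IsEquivariantModuleAlgebra G ρ) (x : A) (z : A ⊗[k] A) (y : K) :
    ρ y (sandwich k x z) = TensorProduct.lift
      ((sandwichBilinear k A).compl₁₂ (ρ.flip x) ((tensorAction ρ).flip z))
      (moveSecondToFront k K (comulTwice k K y)) := by
  induction z with
  | zero =>
    generalize moveSecondToFront k K (comulTwice k K y) = w
    induction w <;> simp_all
  | add a b ha hb =>
    rw [map_add, map_add, ha, hb]
    generalize moveSecondToFront k K (comulTwice k K y) = w
    induction w with
    | zero => simp
    | add p q hp hq => rw [map_add, map_add, map_add, ← hp, ← hq]; abel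
    | tmul p q => simp
  | tmul a b =>
    rw [sandwich_tmul, hρ.apply_mul', comulTwice, LinearMap.comp_apply]
    generalize (Coalgebra.comul (R := k) y) = w
    induction w with
    | zero => simp
    | add p q hp hq => simp only [map_add, LinearMap.add_apply, hp, hq]
    | tmul p r =>
      rw [tensorAction_tmul, TensorProduct.map_tmul, LinearMap.mul'_apply, hρ.apply_mul',
        LinearMap.rTensor_tmul]
      generalize (Coalgebra.comul (R := k) p) = v
      induction v with
      | zero => simp
      | add p q hp hq =>
        simp only [map_add, LinearMap.add_apply, add_mul, TensorProduct.add_tmul, hp, hq]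
      | tmul p q => simp [sandwichBilinear_apply]

/-- The action on `h^[1] x h^[2]` in terms of the coadjoint coaction. -/
lemma apply_sandwich_of_galoisCan_eq (hρ : IsEquivariantModuleAlgebra G ρ)
    (hcan : Function.Injective (galoisCan k G A)) {h : G → k} {T : A ⊗[k] A}
    (hT : galoisCan k G A T = 1 ⊗ₜ h) (x : A) (y : K) :
    ρ y (sandwich k x T) = TensorProduct.lift
      ((sandwichBilinear k A).compl₁₂ (ρ.flip x)
        ((tensorAction ρ).flip T ∘ₗ TensorProduct.mk k K K 1)) (coadjoint k K y) := by
  rw [hρ.apply_sandwich, coadjoint, LinearMap.comp_apply, LinearMap.comp_apply]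
  generalize moveSecondToFront k K (comulTwice k K y) = w
  induction w with
  | zero => simp
  | add p q hp hq => simp only [map_add, hp, hq]
  | tmul q v =>
    induction v with
    | zero => simp
    | add a b ha hb => simp only [TensorProduct.tmul_add, map_add, ha, hb]
    | tmul p r =>
      -- The action of `y₁` on the first leg of `T` moves to the second leg as `S(y₁)`, before `y₃`
      -- acts there.
      have e1 : p ⊗ₜ[k] r = (p ⊗ₜ[k] (1 : K)) * ((1 : K) ⊗ₜ[k] r) := by simp
      have e2 : (1 : K) ⊗ₜ[k] (HopfAlgebra.antipode k p * r) =
          ((1 : K) ⊗ₜ[k] HopfAlgebra.antipode k p) * ((1 : K) ⊗ₜ[k] r) := by simp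
      simp only [TensorProduct.lift.tmul, LinearMap.compl₁₂_apply, LinearMap.flip_apply,
        LinearMap.lTensor_tmul, antipodeMul_tmul, LinearMap.comp_apply, TensorProduct.mk_apply]
      rw [e1, e2, hρ.tensorAction_mul, hρ.tensorAction_mul, hρ.tensorAction_tmul_one hcan hT]

end IsEquivariantModuleAlgebra

end ModuleAlgebra

/-! ### The quotient of the twisted group algebra; conormality when `J ∈ kF ⊗ kF`. -/

section TwistedGroupAlgebraQuotient

open Module

variable {k G : Type*} [Field k] [Group G]

lemma MonoidAlgebra.linearMap_ext_single {M : Type*} [AddCommMonoid M] [Module k M]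
    {f g : MonoidAlgebra k G →ₗ[k] M}
    (h : ∀ u, f (MonoidAlgebra.single u 1) = g (MonoidAlgebra.single u 1)) : f = g := by
  refine LinearMap.ext fun x => ?_
  induction x using MonoidAlgebra.induction_linear with
  | zero => simp
  | add a b ha hb => rw [map_add, map_add, ha, hb]
  | single u c =>
    have : MonoidAlgebra.single u c = c • (MonoidAlgebra.single u 1 : MonoidAlgebra k G) := by
      rw [MonoidAlgebra.smul_single, smul_eq_mul, mul_one]
    rw [this, map_smul, map_smul, h]

namespace HopfTwist

variable (J : HopfTwist k (MonoidAlgebra k G)) (F : Subgroup G) [F.Normal]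

/-- The projection `kG → k(G/F)`. -/
def quotientProj : MonoidAlgebra k G →ₐ[k] MonoidAlgebra k (G ⧸ F) :=
  (MonoidAlgebra.mapDomainBialgHom k (QuotientGroup.mk' F) :
    MonoidAlgebra k G →ₐ[k] MonoidAlgebra k (G ⧸ F))

lemma quotientProj_single (u : G) (c : k) :
    quotientProj F (MonoidAlgebra.single u c) = MonoidAlgebra.single (u : G ⧸ F) c :=
  MonoidAlgebra.mapDomainBialgHom_single _ _ _

/-- The functionals on the twisted group algebra which factor through `k(G/F)`. -/
def quotientDual : Submodule k (Dual k J.Twisted) :=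
  LinearMap.range ((twistedQuotient J F : J.Twisted →ₐ[k]
    (J.map (MonoidAlgebra.mapDomainBialgHom k (QuotientGroup.mk' F))).Twisted).toLinearMap.dualMap)

variable {F} in
lemma mem_quotientDual_iff_exists (φ : Dual k (MonoidAlgebra k G)) :
    (show Dual k J.Twisted from φ) ∈ quotientDual J F ↔
      ∃ ψ : Dual k (MonoidAlgebra k (G ⧸ F)), φ = ψ ∘ₗ (quotientProj F).toLinearMap := by
  constructor
  · rintro ⟨ψ, hψ⟩
    exact ⟨ψ, hψ.symm⟩
  · rintro ⟨ψ, hψ⟩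
    exact ⟨ψ, hψ.symm⟩

variable {F} in
lemma mem_quotientDual_iff (φ : Dual k (MonoidAlgebra k G)) :
    (show Dual k J.Twisted from φ) ∈ quotientDual J F ↔
      ∀ n ∈ F, ∀ x, φ (x * MonoidAlgebra.single n 1) = φ x := by
  rw [mem_quotientDual_iff_exists]
  constructor
  · rintro ⟨ψ, rfl⟩ n hn x
    have : quotientProj F (MonoidAlgebra.single n (1 : k)) = 1 := by
      rw [quotientProj_single, (QuotientGroup.eq_one_iff n).2 hn, MonoidAlgebra.one_def]
    simp [this]
  · intro h
    have hb : ∀ u v : G, (u : G ⧸ F) = v →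
        φ (MonoidAlgebra.single u 1) = φ (MonoidAlgebra.single v 1) := by
      intro u v huv
      have := h (u⁻¹ * v) (QuotientGroup.eq.1 huv) (MonoidAlgebra.single u 1)
      rw [MonoidAlgebra.single_mul_single, mul_inv_cancel_left, mul_one] at this
      exact this.symm
    let ψ : Dual k (MonoidAlgebra k (G ⧸ F)) :=
      (Finsupp.lift k k (G ⧸ F) fun q => φ (MonoidAlgebra.single q.out 1)) ∘ₗ
        (MonoidAlgebra.coeffLinearEquiv k).toLinearMap
    refine ⟨ψ, MonoidAlgebra.linearMap_ext_single fun u => ?_⟩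
    rw [LinearMap.comp_apply, AlgHom.toLinearMap_apply, quotientProj_single]
    have : ψ (MonoidAlgebra.single (u : G ⧸ F) 1) =
        φ (MonoidAlgebra.single (u : G ⧸ F).out 1) := by
      simp [ψ]
    rw [this]
    exact hb _ _ (QuotientGroup.out_eq' _).symm

lemma twistedQuotient_surjective : Function.Surjective (twistedQuotient J F) := by
  have h : Function.Surjective (quotientProj (k := k) F) := by
    intro x
    induction x using MonoidAlgebra.induction_linear with
    | zero => exact ⟨0, map_zero _⟩
    | add a b ha hb =>
      obtain ⟨a, rfl⟩ := ha
      obtain ⟨b, rfl⟩ := hb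
      exact ⟨a + b, map_add _ _ _⟩
    | single q c =>
      obtain ⟨u, rfl⟩ := QuotientGroup.mk_surjective q
      exact ⟨MonoidAlgebra.single u c, quotientProj_single F u c⟩
  exact h

variable {J F}

/-- On `kF` the projection to `k(G/F)` is the counit; so one projected leg of a twist in `kF ⊗ kF`
collapses by the normalization of `J`. -/
lemma quotientProj_comp_subtype :
    (quotientProj F).comp (MonoidAlgebra.mapDomainAlgHom k k F.subtype) =
      ((Algebra.ofId k (MonoidAlgebra k (G ⧸ F))).comp
        (Bialgebra.counitAlgHom k (MonoidAlgebra k G))).comp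
        (MonoidAlgebra.mapDomainAlgHom k k F.subtype) := by
  refine AlgHom.toLinearMap_injective (MonoidAlgebra.linearMap_ext_single fun n => ?_)
  simp only [AlgHom.toLinearMap_apply, AlgHom.comp_apply, MonoidAlgebra.mapDomainAlgHom_apply,
    MonoidAlgebra.mapDomain_single, quotientProj_single, Subgroup.coe_subtype,
    Bialgebra.counitAlgHom_apply, MonoidAlgebra.counit_single]
  rw [(QuotientGroup.eq_one_iff (n : G)).2 n.2]
  simp

lemma map_id_quotientProj_val (hJ : (J.val : MonoidAlgebra k G ⊗[k] MonoidAlgebra k G) ∈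
    subgroupTensor k F) :
    Algebra.TensorProduct.map (AlgHom.id k (MonoidAlgebra k G)) (quotientProj F)
      (J.val : MonoidAlgebra k G ⊗[k] MonoidAlgebra k G) = 1 := by
  have h1 : ∀ z, Algebra.TensorProduct.map (AlgHom.id k (MonoidAlgebra k G))
      ((Algebra.ofId k (MonoidAlgebra k (G ⧸ F))).comp
        (Bialgebra.counitAlgHom k (MonoidAlgebra k G))) z =
      Algebra.TensorProduct.rid k k (MonoidAlgebra k G)
        (Algebra.TensorProduct.map (AlgHom.id k (MonoidAlgebra k G))
          (Bialgebra.counitAlgHom k (MonoidAlgebra k G)) z) ⊗ₜ[k]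
        (1 : MonoidAlgebra k (G ⧸ F)) := by
    intro z
    induction z with
    | zero => simp
    | add a b ha hb => simp only [map_add, ha, hb, TensorProduct.add_tmul]
    | tmul a b => simp [Algebra.ofId_apply, Algebra.algebraMap_eq_smul_one,
        TensorProduct.smul_tmul]
  have h2 := h1 J.val
  rw [J.counit_right, ← Algebra.TensorProduct.one_def] at h2
  rw [← h2]
  obtain ⟨j, hj⟩ := hJ
  rw [← hj]
  change (Algebra.TensorProduct.map _ _).comp (Algebra.TensorProduct.map _ _) j =
    (Algebra.TensorProduct.map _ _).comp (Algebra.TensorProduct.map _ _) j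
  rw [← Algebra.TensorProduct.map_comp, quotientProj_comp_subtype, Algebra.TensorProduct.map_comp]

lemma map_quotientProj_id_val (hJ : (J.val : MonoidAlgebra k G ⊗[k] MonoidAlgebra k G) ∈
    subgroupTensor k F) :
    Algebra.TensorProduct.map (quotientProj F) (AlgHom.id k (MonoidAlgebra k G))
      (J.val : MonoidAlgebra k G ⊗[k] MonoidAlgebra k G) = 1 := by
  have h1 : ∀ z, Algebra.TensorProduct.map
      ((Algebra.ofId k (MonoidAlgebra k (G ⧸ F))).comp
        (Bialgebra.counitAlgHom k (MonoidAlgebra k G))) (AlgHom.id k (MonoidAlgebra k G)) z =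
      (1 : MonoidAlgebra k (G ⧸ F)) ⊗ₜ[k] Algebra.TensorProduct.lid k (MonoidAlgebra k G)
        (Algebra.TensorProduct.map (Bialgebra.counitAlgHom k (MonoidAlgebra k G))
          (AlgHom.id k (MonoidAlgebra k G)) z) := by
    intro z
    induction z with
    | zero => simp
    | add a b ha hb => simp only [map_add, ha, hb, TensorProduct.tmul_add]
    | tmul a b => simp [Algebra.ofId_apply, Algebra.algebraMap_eq_smul_one,
        TensorProduct.smul_tmul]
  have h2 := h1 J.val
  rw [J.counit_left, ← Algebra.TensorProduct.one_def] at h2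
  rw [← h2]
  obtain ⟨j, hj⟩ := hJ
  rw [← hj]
  change (Algebra.TensorProduct.map _ _).comp (Algebra.TensorProduct.map _ _) j =
    (Algebra.TensorProduct.map _ _).comp (Algebra.TensorProduct.map _ _) j
  rw [← Algebra.TensorProduct.map_comp, quotientProj_comp_subtype, Algebra.TensorProduct.map_comp]

/-- An algebra homomorphism which sends a twist to `1` does not see the difference between the
twisted and the original comultiplication. -/
lemma algHom_twistedComul_of_val_eq_one {H B : Type*} [Ring H] [HopfAlgebra k H] [Ring B]
    [Algebra k B] (J : HopfTwist k H) (Ψ : H ⊗[k] H →ₐ[k] B) (h : Ψ J.val = 1) (y : H) :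
    Ψ (J.twistedComul y) = Ψ (Bialgebra.comulAlgHom k H y) := by
  have h' : Ψ ((J.val⁻¹ : (H ⊗[k] H)ˣ) : H ⊗[k] H) = 1 := by
    have h2 := congrArg Ψ J.val.mul_inv
    rwa [map_mul, h, one_mul, map_one] at h2
  rw [twistedComul_apply, map_mul, map_mul, h, h', one_mul, mul_one]

/-- If one of the two functionals factors through `k(G/F)`, the product sees `J` only after
projecting one leg, where `J` becomes `1`. What remains is evaluation on `u ⊗ u`, which is
symmetric. -/
lemma dualMul_comm_of_mem_quotientDual
    (hJ : (J.val : MonoidAlgebra k G ⊗[k] MonoidAlgebra k G) ∈ subgroupTensor k F)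
    (f g : Dual k J.Twisted) (hg : g ∈ quotientDual J F) :
    dualMul k J.Twisted f g = dualMul k J.Twisted g f := by
  obtain ⟨ψ, hψ⟩ := (mem_quotientDual_iff_exists J g).1 hg
  let f' : Dual k (MonoidAlgebra k G) := f
  let g' : Dual k (MonoidAlgebra k G) := ψ ∘ₗ (quotientProj F).toLinearMap
  have hR : ∀ z, TensorProduct.dualDistrib k _ _ (f' ⊗ₜ[k] g') z =
      TensorProduct.dualDistrib k _ _ (f' ⊗ₜ[k] ψ)
        (Algebra.TensorProduct.map (AlgHom.id k (MonoidAlgebra k G)) (quotientProj F) z) := by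
    intro z
    induction z with
    | zero => simp
    | add a b ha hb => simp only [map_add, ha, hb]
    | tmul a b => simp [g']
  have hL : ∀ z, TensorProduct.dualDistrib k _ _ (g' ⊗ₜ[k] f') z =
      TensorProduct.dualDistrib k _ _ (ψ ⊗ₜ[k] f')
        (Algebra.TensorProduct.map (quotientProj F) (AlgHom.id k (MonoidAlgebra k G)) z) := by
    intro z
    induction z with
    | zero => simp
    | add a b ha hb => simp only [map_add, ha, hb]
    | tmul a b => simp [g']
  have key : (TensorProduct.dualDistrib k _ _ (f' ⊗ₜ[k] g')) ∘ₗ J.twistedComul.toLinearMap =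
      (TensorProduct.dualDistrib k _ _ (g' ⊗ₜ[k] f')) ∘ₗ J.twistedComul.toLinearMap := by
    refine MonoidAlgebra.linearMap_ext_single fun u => ?_
    rw [LinearMap.comp_apply, LinearMap.comp_apply, AlgHom.toLinearMap_apply, hR, hL,
      algHom_twistedComul_of_val_eq_one J _ (map_id_quotientProj_val hJ),
      algHom_twistedComul_of_val_eq_one J _ (map_quotientProj_id_val hJ)]
    simp [mul_comm]
  subst hψ
  exact key

/-- If `J ∈ kF ⊗ kF`, then the quotient `(kG)^J → k(G/F)^{J̄}` is conormal. -/
lemma isConormal_of_mem_subgroupTensor [Finite G]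
    (hJ : (J.val : MonoidAlgebra k G ⊗[k] MonoidAlgebra k G) ∈ subgroupTensor k F) :
    IsConormal (twistedQuotient J F) :=
  ⟨twistedQuotient_surjective J F, isNormalInDual_of_central fun f g hg =>
    dualMul_comm_of_mem_quotientDual hJ f g hg⟩

end HopfTwist

lemma subgroupTensor_mono {S F : Subgroup G} (h : S ≤ F) :
    subgroupTensor k S ≤ subgroupTensor k F := by
  rintro _ ⟨j, rfl⟩
  have hι : (MonoidAlgebra.mapDomainAlgHom k k F.subtype).comp
      (MonoidAlgebra.mapDomainAlgHom k k (Subgroup.inclusion h)) =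
      MonoidAlgebra.mapDomainAlgHom k k S.subtype := by
    rw [← MonoidAlgebra.mapDomainAlgHom_comp]
    rfl
  refine ⟨Algebra.TensorProduct.map (MonoidAlgebra.mapDomainAlgHom k k (Subgroup.inclusion h))
    (MonoidAlgebra.mapDomainAlgHom k k (Subgroup.inclusion h)) j, ?_⟩
  change (Algebra.TensorProduct.map _ _).comp (Algebra.TensorProduct.map _ _) j = _
  rw [← Algebra.TensorProduct.map_comp, hι]
  rfl

/-! ### The crossed product as a module algebra over `(kG)^J`; conormality implies stability. -/

section CrossedProduct

variable {A : Type*} [Ring A] [Algebra k A] {J : HopfTwist k (MonoidAlgebra k G)}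

/-- The right action of `kG` on `A ≅ (kG)*` dual to left multiplication. -/
def dualAction (e : A ≃ₗ[k] Dual k (MonoidAlgebra k G)) :
    MonoidAlgebra k G →ₗ[k] A →ₗ[k] A :=
  LinearMap.mk₂ k (fun y a => e.symm (e a ∘ₗ LinearMap.mulLeft k y))
    (fun y y' a => by
      rw [← map_add]; congr 1; ext x; simp [add_mul])
    (fun c y a => by
      rw [← map_smul]; congr 1; ext x; simp)
    (fun y a b => by
      rw [← map_add]; congr 1; ext x; simp)
    (fun c y a => by
      rw [← map_smul]; congr 1; ext x; simp)

lemma apply_dualAction (e : A ≃ₗ[k] Dual k (MonoidAlgebra k G)) (y x : MonoidAlgebra k G)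
    (a : A) : e (dualAction e y a) x = e a (y * x) := by
  change e (e.symm _) x = _
  rw [LinearEquiv.apply_symm_apply]
  rfl

lemma dualAction_mul (e : A ≃ₗ[k] Dual k (MonoidAlgebra k G)) (p q : MonoidAlgebra k G) (a : A) :
    dualAction e (p * q) a = dualAction e q (dualAction e p a) := by
  apply e.injective
  refine LinearMap.ext fun x => ?_
  rw [apply_dualAction, apply_dualAction, apply_dualAction, ← mul_assoc]

lemma dualAction_one (e : A ≃ₗ[k] Dual k (MonoidAlgebra k G)) (a : A) :
    dualAction e 1 a = a := by
  apply e.injective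
  refine LinearMap.ext fun x => ?_
  rw [apply_dualAction, one_mul]

lemma dualAction_apply_one {e : A ≃ₗ[k] Dual k (MonoidAlgebra k G)}
    (he1 : e 1 = Coalgebra.counit) (y : MonoidAlgebra k G) :
    dualAction e y 1 = Coalgebra.counit (R := k) y • (1 : A) := by
  apply e.injective
  refine LinearMap.ext fun x => ?_
  rw [apply_dualAction, map_smul, he1]
  exact map_mul (Bialgebra.counitAlgHom k (MonoidAlgebra k G)) y x

/-- The product of `A` evaluates functionals on `J Δ(x)`, and `J Δ(yx) = (J Δ(y) J⁻¹) J Δ(x)`; hence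
the twisted comultiplication is the one that governs the action on products. -/
lemma dualAction_apply_mul {e : A ≃ₗ[k] Dual k (MonoidAlgebra k G)}
    (hemul : ∀ a b : A, e (a * b) = crossedMul J (e a) (e b)) (y : MonoidAlgebra k G) (a b : A) :
    dualAction e y (a * b) =
      LinearMap.mul' k A (tensorAction (dualAction e) (J.twistedComul y) (a ⊗ₜ b)) := by
  apply e.injective
  refine LinearMap.ext fun x => ?_
  have h1 : ∀ w, e (LinearMap.mul' k A (tensorAction (dualAction e) w (a ⊗ₜ b))) x =
      TensorProduct.dualDistrib k _ _ (e a ⊗ₜ[k] e b)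
        (w * ((J.val : MonoidAlgebra k G ⊗[k] MonoidAlgebra k G) *
          Bialgebra.comulAlgHom k (MonoidAlgebra k G) x)) := by
    intro w
    induction w with
    | zero => simp
    | add v w hv hw => simp only [map_add, LinearMap.add_apply, hv, hw, add_mul]
    | tmul p q =>
      rw [tensorAction_tmul, TensorProduct.map_tmul, LinearMap.mul'_apply, hemul]
      change TensorProduct.dualDistrib k _ _ (e (dualAction e p a) ⊗ₜ[k] e (dualAction e q b))
        ((J.val : MonoidAlgebra k G ⊗[k] MonoidAlgebra k G) *
          Bialgebra.comulAlgHom k (MonoidAlgebra k G) x) = _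
      generalize (J.val : MonoidAlgebra k G ⊗[k] MonoidAlgebra k G) *
          Bialgebra.comulAlgHom k (MonoidAlgebra k G) x = z
      induction z with
      | zero => simp
      | add v w hv hw => simp only [map_add, hv, hw, mul_add]
      | tmul v w => simp [apply_dualAction]
  rw [h1, apply_dualAction, hemul, HopfTwist.twistedComul_apply]
  change TensorProduct.dualDistrib k _ _ (e a ⊗ₜ[k] e b)
        ((J.val : MonoidAlgebra k G ⊗[k] MonoidAlgebra k G) *
          Bialgebra.comulAlgHom k (MonoidAlgebra k G) (y * x)) = _
  rw [map_mul (Bialgebra.comulAlgHom k (MonoidAlgebra k G))]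
  simp only [mul_assoc, Units.inv_mul_cancel_left]

variable [MulSemiringAction G A] [SMulCommClass G k A]

lemma dualAction_smul {e : A ≃ₗ[k] Dual k (MonoidAlgebra k G)}
    (heG : ∀ (g : G) (a : A) (x : MonoidAlgebra k G),
      e (g • a) x = e a (x * MonoidAlgebra.single g 1)) (y : MonoidAlgebra k G) (g : G) (a : A) :
    dualAction e y (g • a) = g • dualAction e y a := by
  apply e.injective
  refine LinearMap.ext fun x => ?_
  rw [apply_dualAction, heG, heG, apply_dualAction, mul_assoc]

/-- The crossed product `(k^G)^{(J)}` is a module algebra over `(kG)^J`. -/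
lemma isEquivariantModuleAlgebra_dualAction (e : A ≃ₗ[k] Dual k (MonoidAlgebra k G))
    (he1 : e 1 = Coalgebra.counit)
    (hemul : ∀ a b : A, e (a * b) = crossedMul J (e a) (e b))
    (heG : ∀ (g : G) (a : A) (x : MonoidAlgebra k G),
      e (g • a) x = e a (x * MonoidAlgebra.single g 1)) :
    IsEquivariantModuleAlgebra (K := J.Twisted) G
      (show J.Twisted →ₗ[k] A →ₗ[k] A from dualAction e) where
  mul_apply := dualAction_mul e
  one_apply := dualAction_one e
  apply_one := dualAction_apply_one he1
  apply_mul := dualAction_apply_mul hemul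
  apply_smul := dualAction_smul heG

variable [Fintype G] [DecidableEq G]

/-- If the quotient `(kG)^J → k(G/F)^{J̄}` is conormal, then the `F`-invariants of the Galois
object corresponding to `J` are stable under the Miyashita-Ulbrich action. -/
lemma HopfTwist.CorrespondsTo.isMiyashitaUlbrichStable (hJ : J.CorrespondsTo A)
    (hA : IsGaloisObject k G A) {F : Subgroup G} [F.Normal]
    (hF : IsConormal (twistedQuotient J F)) :
    IsMiyashitaUlbrichStable G (fixedSubspace k A F) := by
  obtain ⟨e, he1, hemul, heG⟩ := hJ
  have hcan := hA.can_bijective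
  let ρ : J.Twisted →ₗ[k] A →ₗ[k] A := dualAction e
  have hρ : IsEquivariantModuleAlgebra (K := J.Twisted) G ρ :=
    isEquivariantModuleAlgebra_dualAction e he1 hemul heG
  have hfix : ∀ a : A, a ∈ fixedSubspace k A F ↔
      (show Dual k J.Twisted from e a) ∈ HopfTwist.quotientDual J F := by
    intro a
    rw [HopfTwist.mem_quotientDual_iff]
    refine forall₂_congr fun n _ => ?_
    rw [← e.injective.eq_iff, LinearMap.ext_iff]
    simp only [heG]
  intro a ha h
  obtain ⟨T, hT⟩ := hcan.2 (1 ⊗ₜ h)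
  rw [miyashitaUlbrich_eq hcan.1 a hT, hfix]
  -- Evaluation at `1` recovers the whole functional from the action: `e x y = ℓ (ρ y x)`.
  let ℓ : A →ₗ[k] k := LinearMap.applyₗ (1 : MonoidAlgebra k G) ∘ₗ e.toLinearMap
  let N : J.Twisted ⊗[k] J.Twisted →ₗ[k] A := TensorProduct.lift
      ((sandwichBilinear k A).compl₁₂ (ρ.flip a)
        ((tensorAction ρ).flip T ∘ₗ TensorProduct.mk k J.Twisted J.Twisted 1))
  have h1 : (show Dual k J.Twisted from e (sandwich k a T)) =
      (ℓ ∘ₗ N) ∘ₗ coadjoint k J.Twisted := by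
    refine LinearMap.ext fun y => ?_
    have h2 := hρ.apply_sandwich_of_galoisCan_eq hcan.1 hT a y
    change e (sandwich k a T) y = e (N (coadjoint k J.Twisted y)) 1
    rw [← h2]
    exact ((apply_dualAction e y 1 _).trans (congrArg _ (mul_one (M := MonoidAlgebra k G) y))).symm
  rw [h1]
  refine hF.2.comp_coadjoint_mem (ℓ ∘ₗ N) fun w => ?_
  refine (HopfTwist.mem_quotientDual_iff J (F := F)
    ((ℓ ∘ₗ N) ∘ₗ (TensorProduct.mk k J.Twisted J.Twisted).flip w)).2 fun n hn q => ?_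
  -- The slices of `ℓ ∘ N` depend on `q` only through `ρ q a`. Right `F`-invariance of `e a` gives
  -- this equality because `q n u = q u (u⁻¹nu)` and `F` is normal.
  have h3 : dualAction e (q * MonoidAlgebra.single n 1) a = dualAction e q a := by
    apply e.injective
    refine MonoidAlgebra.linearMap_ext_single fun u => ?_
    have h4 := (HopfTwist.mem_quotientDual_iff J (F := F) (e a)).1 ((hfix a).1 ha)
      (u⁻¹ * n * u) (by simpa using (inferInstance : F.Normal).conj_mem n hn u⁻¹)
      (q * MonoidAlgebra.single u 1)
    rw [apply_dualAction, apply_dualAction, ← h4, mul_assoc, mul_assoc,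
      MonoidAlgebra.single_mul_single, MonoidAlgebra.single_mul_single]
    simp [mul_assoc]
  change ℓ (sandwich k (dualAction e (q * MonoidAlgebra.single n 1) a) _) =
    ℓ (sandwich k (dualAction e q a) _)
  rw [h3]

end CrossedProduct

end TwistedGroupAlgebraQuotient

end

theorem theorem6p2 {k G : Type*} [Field k] [IsAlgClosed k] [CharZero k]
    [Group G] [Fintype G] [DecidableEq G]
    (hZ : Subgroup.center G = ⊥)
    (F : Subgroup G) [F.Normal] (hF : F.index.Prime)
    (S : Subgroup G) (α : TwoCocycle S k) (hα : α.IsNondegenerate) :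
    IsGaloisObject k G (galoisObject α) ∧
    (IsMiyashitaUlbrichStable G (fixedSubspace k (galoisObject α) F) ↔ S ≤ F) ∧
    ∀ J : HopfTwist k (MonoidAlgebra k G),
      (J.val : MonoidAlgebra k G ⊗[k] MonoidAlgebra k G) ∈ subgroupTensor k S →
      J.CorrespondsTo (galoisObject α) →
        (IsConormal (twistedQuotient J F) ↔
          (J.val : MonoidAlgebra k G ⊗[k] MonoidAlgebra k G) ∈ subgroupTensor k F) ∧
        (IsConormal (twistedQuotient J F) ↔
          IsMiyashitaUlbrichStable G (fixedSubspace k (galoisObject α) F)) := by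
  have := Fintype.ofFinite S
  have hA : IsGaloisObject k G (galoisObject α) := galoisObject.isGaloisObject hα
  have h1 : IsMiyashitaUlbrichStable G (fixedSubspace k (galoisObject α) F) ↔ S ≤ F :=
    ⟨galoisObject.le_of_isMiyashitaUlbrichStable hα hZ hF,
      galoisObject.isMiyashitaUlbrichStable_of_le hα⟩
  refine ⟨hA, h1, fun J hJS hJ => ?_⟩
  have h2 : IsConormal (twistedQuotient J F) →
      IsMiyashitaUlbrichStable G (fixedSubspace k (galoisObject α) F) :=
    fun h => hJ.isMiyashitaUlbrichStable hA h
  have h3 : S ≤ F →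
      (J.val : MonoidAlgebra k G ⊗[k] MonoidAlgebra k G) ∈ subgroupTensor k F :=
    fun h => subgroupTensor_mono h hJS
  exact ⟨⟨fun h => h3 (h1.1 (h2 h)), HopfTwist.isConormal_of_mem_subgroupTensor⟩,
    h2, fun h => HopfTwist.isConormal_of_mem_subgroupTensor (h3 (h1.1 h))⟩
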